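/- **Conventions.** $\mathbb N=\{1,2,3,\dots\}$, $[N]=\{1,\dots,N\}$, $e(x)=e^{2\pi i x}$, and $\|x\|_{\mathbb T}$ is the distance from $x\in\mathbb R$ to the nearest integer. Scales are sequences $\mathbf H=(H_s)_{s\in\mathbb N}$ in $\mathbb N$. Write $1\prec\mathbf H$ if $1/H_s\to0$; $\mathbf H\preceq\mathbf N$ if $H_s\le N_s$ for all large $s$; and $\mathbf H\prec\mathbf N$ if $H_s/N_s\to0$. For a sequence $\mathbf N$ put $\mathbb E_{n\in\mathbf N}g(n)=\lim_{s\to\infty}\frac1{N_s}\sum_{n=1}^{N_s}g(n)$ and $\|g\|_{2,\mathbf N}=(\mathbb E_{n\in\mathbf N}|g(n)|^2)^{1/2}$, when these limits exist. For a finite abelian group $G$ and $g\colon G\to\mathbb C$ let $$\|g\|_{U^2(G)}=\Big(\tfrac1{|G|^3}\sum_{x,h_1,h_2\in G}g(x)\overline{g(x+h_1)}\,\overline{g(x+h_2)}\,g(x+h_1+h_2)\Big)^{1/4}.$$ For $g\colon\mathbb N\to\mathbb C$ let $\|g\|_{U^2(\{x+1,\dots,x+L\})}=\|\tilde g\|_{U^2(\mathbb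 Z/4L\mathbb Z)}/\|1_{[L]}\|_{U^2(\mathbb Z/4L\mathbb Z)}$, where $\tilde g(n)=1_{[L]}(n)g(x+n)$. If $1\prec\mathbf H\preceq\mathbf N$ and $g$ is bounded, let $$\|g\|_{U^2(\mathbf N,\mathbf H)}=\lim_{s\to\infty}\frac1{N_s-H_s+1}\sum_{n=1}^{N_s-H_s+1}\|g\|_{U^2(\{n,\dots,n+H_s-1\})},$$ when the limit exists. **Definition.** Let $f\colon\mathbb N\to[0,1]$ and $1\prec\mathbf H\preceq\mathbf N$. The pair $(\mathbf N,\mathbf H)$ is a *$U^2$ good scale* for $f$ if there is a decomposition $f=f_{\mathrm{str}}+f_{\mathrm{unf}}$ such that: 1. (Nonnegativity) $f_{\mathrm{str}}$ takes values in $[0,1]$, and $\mathbb E_{n\in\mathbf N}f_{\mathrm{unf}}(n)$ exists and equals $0$. 2. (Structure) For every $\epsilon>0$ there exist $d\in\mathbb N$, functions $c_1,\dots,c_d\colon\mathbb N\to\mathbb C$ with $\|c_i\|_\infty\le1$, and $\alpha_1,\dots,\alpha_d\colon\mathbb N\to\mathbb R$ such that, with $\mathcal P(n)=\sum_{i=1}^dc_i(n)e(n\alpha_i(n))$,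 the norm $\|\mathcal P-f_{\mathrm{str}}\|_{2,\mathbf N}$ is well defined and at most $\epsilon$. Moreover, for every real $C\ge1$, if $$\Gamma^{(1)}_s=\{n\in[N_s-H_s+1]:\alpha_i(n+m_1)=\alpha_i(n+m_2)\ \forall i\in[d],\ \forall m_1,m_2\in[H_s]\},$$ $$\Gamma^{(2)}_s=\{n\in[N_s-H_s+1]:c_i(n+m_1)=c_i(n+m_2)\ \forall i\in[d],\ \forall m_1,m_2\in[H_s]\},$$ and $W_{s,C}$ is the set of $n\in[N_s-H_s+1]$ such that every $(w_1,\dots,w_d)\in[-C,C]^d\cap\mathbb Z^d$ satisfies $$\|w_1\alpha_1(n)+\dots+w_d\alpha_d(n)\|_{\mathbb T}\le\tfrac1{CH_s}\quad\text{or}\quad\|w_1\alpha_1(n)+\dots+w_d\alpha_d(n)\|_{\mathbb T}\ge\tfrac C{H_s},$$ then $$\lim_{s\to\infty}\frac{|\Gamma^{(1)}_s|}{N_s-H_s+1}=\lim_{s\to\infty}\frac{|\Gamma^{(2)}_s|}{N_s-H_s+1}=\lim_{s\to\infty}\frac{|W_{s,C}|}{N_s-H_s+1}=1.$$ 3. (Uniformity)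 There is $\mathbf H'$ with $1\prec\mathbf H'\prec\mathbf H$ such that $\|f_{\mathrm{unf}}\|_{U^2(\mathbf N,\mathbf H')}$ is well defined and equals $0$. **Theorem.** Let $f\colon\mathbb N\to[0,1]$, and let $\mathbf N$, $\mathbf K^+$, $\mathbf K^-$ be sequences in $\mathbb N$ with $1\prec\mathbf K^-\prec\mathbf K^+\preceq\mathbf N$. After replacing $(\mathbf N,\mathbf K^+,\mathbf K^-)$ by a subsequence, i.e. by $(N_{t(s)},K^+_{t(s)},K^-_{t(s)})_{s\in\mathbb N}$ for some strictly increasing $t\colon\mathbb N\to\mathbb N$, there exist sequences $\mathbf H^+$ and $\mathbf H^-$ in $\mathbb N$ with $$\mathbf K^-\preceq\mathbf H^-\prec\mathbf H^+\preceq\mathbf K^+$$ such that for every sequence $\mathbf H$ in $\mathbb N$ with $\mathbf H^-\prec\mathbf H\prec\mathbf H^+$ the pair $(\mathbf N,\mathbf H)$ is a $U^2$ good scale for $f$. -/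

import Mathlib

open Filter Topology

noncomputable section

/-- A scale: a sequence of positive integers. -/
abbrev Scale : Type := ℕ → ℕ+

namespace Scale

/-- `1 ≺ H`. -/
def OnePrec (H : Scale) : Prop :=
  Tendsto (fun s => 1 / ((H s : ℕ) : ℝ)) atTop (𝓝 0)

/-- `H ≺ N`. -/
def Prec (H N : Scale) : Prop :=
  Tendsto (fun s => ((H s : ℕ) : ℝ) / ((N s : ℕ) : ℝ)) atTop (𝓝 0)

/-- `H ⪯ N`. -/
def PrecEq (H N : Scale) : Prop :=
  ∀ᶠ s in atTop, H s ≤ N s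

end Scale

/-- `e(x) = exp(2πix)`. -/
def expTwoPiI (x : ℝ) : ℂ :=
  Complex.exp (2 * Real.pi * Complex.I * x)

/-- The `U²` Gowers norm on a finite abelian group. The sum is a non-negative real number,
so taking its norm only changes its type. -/
def gowersU2 {G : Type*} [AddCommGroup G] [Fintype G] (f : G → ℂ) : ℝ :=
  ‖(1 / (Fintype.card G : ℂ) ^ 3) *
      ∑ x : G, ∑ h₁ : G, ∑ h₂ : G,
        f x * starRingEnd ℂ (f (x + h₁)) * starRingEnd ℂ (f (x + h₂)) * f (x + h₁ + h₂)‖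
    ^ (1 / 4 : ℝ)

/-- The function `n ↦ 1_{[L]}(n) f(x + n)` on `ℤ/4Lℤ`, where `[L] = {1, …, L}`. -/
def cyclicLift (f : ℕ → ℂ) (x : ℕ) (L : ℕ+) : ZMod (4 * (L : ℕ)) → ℂ :=
  fun a => if 1 ≤ a.val ∧ a.val ≤ (L : ℕ) then f (x + a.val) else 0

/-- The `U²` Gowers seminorm on the interval `{x + 1, …, x + L}`. The modulus `4L` may be replaced
by any larger one without changing the value. -/
def gowersU2Interval (f : ℕ → ℂ) (x : ℕ) (L : ℕ+) : ℝ :=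
  gowersU2 (cyclicLift f x L) / gowersU2 (cyclicLift (fun _ => 1) 0 L)

/-- The number `N_s - H_s + 1` (of intervals of length `H_s` inside `[N_s]`, if `H_s ≤ N_s`). -/
def numWindows (N H : Scale) (s : ℕ) : ℕ :=
  (N s : ℕ) + 1 - (H s : ℕ)

/-- The seminorm `‖f‖_{U²(N,H)}` is well defined (the limit defining it exists) and equals `L`.
The interval `{n, …, n + H_s - 1}` is `{x + 1, …, x + H_s}` with `x = n - 1`. -/
def HasU2Seminorm (N H : Scale) (f : ℕ → ℂ) (L : ℝ) : Prop :=
  Tendsto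
    (fun s => (1 / (numWindows N H s : ℝ)) *
      ∑ n ∈ Finset.Icc 1 (numWindows N H s), gowersU2Interval f (n - 1) (H s))
    atTop (𝓝 L)

/-- The mean `𝔼_{n ∈ N} f(n)` exists and equals `L`. -/
def HasMeanAlong (N : Scale) (f : ℕ → ℝ) (L : ℝ) : Prop :=
  Tendsto (fun s => (1 / ((N s : ℕ) : ℝ)) * ∑ n ∈ Finset.Icc 1 (N s : ℕ), f n) atTop (𝓝 L)

/-- The norm `‖f‖_{2,N} = (𝔼_{n ∈ N} |f(n)|²)^{1/2}` is well defined and equals `L`. -/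
def HasNormTwoAlong (N : Scale) (f : ℕ → ℂ) (L : ℝ) : Prop :=
  0 ≤ L ∧ HasMeanAlong N (fun n => ‖f n‖ ^ 2) (L ^ 2)

/-- The sets `S_s ⊆ [N_s - H_s + 1]` of those `n` satisfying the `s`-th condition have asymptotically
full proportion: `|S_s| / (N_s - H_s + 1) → 1`. -/
def AsymptoticallyFull (N H : Scale) (S : ℕ → Set ℕ) : Prop :=
  Tendsto
    (fun s => ((S s ∩ Set.Icc 1 (numWindows N H s)).ncard : ℝ) / (numWindows N H s : ℝ))
    atTop (𝓝 1)

/-- All `g i` are constant on `{n + 1, …, n + L}`. -/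
def LocallyConstantSet {d : ℕ} {E : Type*} (g : Fin d → ℕ → E) (L : ℕ+) : Set ℕ :=
  {n | ∀ i : Fin d, ∀ m₁ ∈ Finset.Icc 1 (L : ℕ), ∀ m₂ ∈ Finset.Icc 1 (L : ℕ),
    g i (n + m₁) = g i (n + m₂)}

/-- The set of `n` at which every integer combination of the frequencies `α i n` with coefficients
in `[-C, C]` is at distance at most `1 / (C L)` or at least `C / L` from the nearest integer
(`‖·‖` on `UnitAddCircle` is the distance to the nearest integer). -/
def FrequencyDichotomySet {d : ℕ} (α : Fin d → ℕ → ℝ) (C : ℝ) (L : ℕ+) : Set ℕ :=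
  {n | ∀ w : Fin d → ℤ, (∀ i, |(w i : ℝ)| ≤ C) →
    ‖((∑ i, (w i : ℝ) * α i n : ℝ) : UnitAddCircle)‖ ≤ 1 / (C * ((L : ℕ) : ℝ)) ∨
    C / ((L : ℕ) : ℝ) ≤ ‖((∑ i, (w i : ℝ) * α i n : ℝ) : UnitAddCircle)‖}

/-- The structure condition on `fstr` at the pair of scales `(N, H)`. -/
def U2Structured (N H : Scale) (fstr : ℕ → ℝ) : Prop :=
  ∀ ε : ℝ, 0 < ε →
    ∃ (d : ℕ) (c : Fin d → ℕ → ℂ) (α : Fin d → ℕ → ℝ),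
      0 < d ∧
      (∀ i n, ‖c i n‖ ≤ 1) ∧
      (∃ L : ℝ, L ≤ ε ∧
        HasNormTwoAlong N
          (fun n => (∑ i, c i n * expTwoPiI ((n : ℝ) * α i n)) - (fstr n : ℂ)) L) ∧
      AsymptoticallyFull N H (fun s => LocallyConstantSet α (H s)) ∧
      AsymptoticallyFull N H (fun s => LocallyConstantSet c (H s)) ∧
      ∀ C : ℝ, 1 ≤ C → AsymptoticallyFull N H (fun s => FrequencyDichotomySet α C (H s))

/-- `(N, H)` is a `U²` good scale for `f`. Only the values of `f` at positive integers matter. -/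
def IsU2GoodScale (f : ℕ → ℝ) (N H : Scale) : Prop :=
  H.OnePrec ∧ H.PrecEq N ∧
  ∃ fstr funf : ℕ → ℝ,
    (∀ n, f n = fstr n + funf n) ∧
    (∀ n, 0 ≤ fstr n ∧ fstr n ≤ 1) ∧
    HasMeanAlong N funf 0 ∧
    U2Structured N H fstr ∧
    ∃ H' : Scale, H'.OnePrec ∧ H'.Prec H ∧ HasU2Seminorm N H' (fun n => (funf n : ℂ)) 0

end

/-! Measure a phase sum on `{1, …, N}` by its number `d` of terms and the number `B` of changes of
its data. As the allowance `B` shrinks from about `N / K⁻` to about `N / K⁺`, the least square error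
in approximating `f` grows but stays in `[0, 1]`. By pigeonhole there are two far apart allowances
between which the errors for all `d ≤ D` barely change (`exists_bestErr_stable`). Near-minimisers
for the smaller allowance are then constant on long intervals, yet nearly optimal among sums that
may change much more often. A second pigeonhole, between these two scales, finds a range which small
integer combinations of their frequencies seldom hit (`exists_range_seldom_hit`).

The structured part is a near-minimiser with `r` terms, truncated to `[0, 1]`. By Weierstrass a
truncation is uniformly close to a phase sum of bounded complexity, so it may enter competitors. If
the remainder correlated with phases on windows of length `Hm`, adding such a phase would lower the
error too much (`msq_sub_str_le_add`); the Fourier form of the `U²` inverse theorem turns this into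
uniformity (`sum_gowersU2Interval_le`). By the parallelogram law two nearly optimal approximations
are close to each other, so sums of `d` phases approximate the structured part
(`msq_phaseSum_sub_str_le`).

Along a subsequence the optimal errors converge to a decreasing sequence in `d`. Letting `r` grow
with the stage makes all losses vanish (`exists_strUnf`). Finally `N` is thinned to grow so fast
that the functions of stage `s`, used on `{N_{s-1} + 1, …, N_s}` only, glue to one function that
agrees with stage `s` on almost all of `{1, …, N_s}`. -/

noncomputable section

/-! ### Phase sums with few breaks and their algebra. -/

/-- The exponential sum `∑ i, c i n * e(n * α i n)` with data `u n i = (c i n, α i n)`. -/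
def phaseSum {ι : Type*} [Fintype ι] (u : ℕ → ι → ℂ × ℝ) (n : ℕ) : ℂ :=
  ∑ i, (u n i).1 * expTwoPiI ((n : ℝ) * (u n i).2)

open Classical in
/-- The indices `n < N` at which the sequence `u` changes value. -/
def breakSet {E : Type*} (u : ℕ → E) (N : ℕ) : Finset ℕ :=
  (Finset.range N).filter fun n => u (n + 1) ≠ u n

/-- `P` is a sum of `d` phases whose amplitudes and frequencies change at most `B` times
before `N`. -/
def IsPhase (N d B : ℕ) (P : ℕ → ℂ) : Prop :=
  ∃ u : ℕ → Fin d → ℂ × ℝ, (∀ n i, ‖(u n i).1‖ ≤ 1) ∧ (∀ n, P n = phaseSum u n) ∧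
    (breakSet u N).card ≤ B

theorem expTwoPiI_add (x y : ℝ) : expTwoPiI (x + y) = expTwoPiI x * expTwoPiI y := by
  simp only [expTwoPiI, ← Complex.exp_add]
  congr 1; push_cast; ring

theorem norm_expTwoPiI (x : ℝ) : ‖expTwoPiI x‖ = 1 := by
  have : (2 * Real.pi * Complex.I * x : ℂ) = ((2 * Real.pi * x : ℝ) : ℂ) * Complex.I := by
    push_cast; ring
  rw [expTwoPiI, this, Complex.norm_exp_ofReal_mul_I]

theorem expTwoPiI_zero : expTwoPiI 0 = 1 := by simp [expTwoPiI]

theorem conj_expTwoPiI (x : ℝ) : starRingEnd ℂ (expTwoPiI x) = expTwoPiI (-x) := by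
  simp [expTwoPiI, ← Complex.exp_conj, map_ofNat]

theorem card_breakSet_le_add {E F G : Type*} {u : ℕ → E} {v : ℕ → F} {w : ℕ → G}
    (h : ∀ n, u (n + 1) = u n → v (n + 1) = v n → w (n + 1) = w n) (N : ℕ) :
    (breakSet w N).card ≤ (breakSet u N).card + (breakSet v N).card := by
  classical
  refine (Finset.card_le_card fun n hn => ?_).trans (Finset.card_union_le _ _)
  simp only [breakSet, Finset.mem_filter, Finset.mem_union] at hn ⊢
  by_contra hc
  push Not at hc
  exact hn.2 (h n (hc.1 hn.1) (hc.2 hn.1))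

theorem card_breakSet_le {E F : Type*} {u : ℕ → E} {w : ℕ → F}
    (h : ∀ n, u (n + 1) = u n → w (n + 1) = w n) (N : ℕ) :
    (breakSet w N).card ≤ (breakSet u N).card := by
  classical
  refine Finset.card_le_card fun n hn => ?_
  simp only [breakSet, Finset.mem_filter] at hn ⊢
  exact ⟨hn.1, fun hc => hn.2 (h n hc)⟩

theorem card_breakSet_const {E : Type*} (a : E) (N : ℕ) :
    (breakSet (fun _ => a) N).card = 0 := by
  simp [breakSet]

namespace IsPhase

variable {N d d' B B' : ℕ} {P Q : ℕ → ℂ}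

theorem of_fintype {ι : Type*} [Fintype ι] (hd : Fintype.card ι = d) (u : ℕ → ι → ℂ × ℝ)
    (hu : ∀ n i, ‖(u n i).1‖ ≤ 1) (hP : ∀ n, P n = phaseSum u n)
    (hB : (breakSet u N).card ≤ B) : IsPhase N d B P := by
  subst hd
  refine ⟨fun n i => u n ((Fintype.equivFin ι).symm i), fun n i => hu _ _, fun n => ?_,
    (card_breakSet_le (fun n hn => by simp only [hn]) N).trans hB⟩
  rw [hP, phaseSum, phaseSum]
  exact ((Fintype.equivFin ι).symm.sum_comp
    fun i => (u n i).1 * expTwoPiI ((n : ℝ) * (u n i).2)).symm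

theorem mono_breaks (hP : IsPhase N d B P) (h : B ≤ B') : IsPhase N d B' P := by
  obtain ⟨u, hu, hPu, hB⟩ := hP
  exact ⟨u, hu, hPu, hB.trans h⟩

theorem add (hP : IsPhase N d B P) (hQ : IsPhase N d' B' Q) :
    IsPhase N (d + d') (B + B') (fun n => P n + Q n) := by
  obtain ⟨u, hu, hPu, hB⟩ := hP
  obtain ⟨v, hv, hQv, hB'⟩ := hQ
  refine of_fintype (ι := Fin d ⊕ Fin d') (by simp) (fun n => Sum.elim (u n) (v n)) ?_ ?_
    ((card_breakSet_le_add (fun n h1 h2 => by simp only [h1, h2]) N).trans (Nat.add_le_add hB hB'))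
  · rintro n (i | i)
    · exact hu n i
    · exact hv n i
  · intro n
    simp [phaseSum, hPu, hQv]

theorem mul (hP : IsPhase N d B P) (hQ : IsPhase N d' B' Q) :
    IsPhase N (d * d') (B + B') (fun n => P n * Q n) := by
  obtain ⟨u, hu, hPu, hB⟩ := hP
  obtain ⟨v, hv, hQv, hB'⟩ := hQ
  refine of_fintype (ι := Fin d × Fin d') (by simp)
    (fun n i => ((u n i.1).1 * (v n i.2).1, (u n i.1).2 + (v n i.2).2)) ?_ ?_
    ((card_breakSet_le_add (fun n h1 h2 => by simp only [h1, h2]) N).trans (Nat.add_le_add hB hB'))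
  · rintro n ⟨i, j⟩
    rw [norm_mul]
    exact mul_le_one₀ (hu n i) (norm_nonneg _) (hv n j)
  · intro n
    simp only [phaseSum, hPu, hQv, Finset.sum_mul_sum, Fintype.sum_prod_type]
    refine Finset.sum_congr rfl fun i _ => Finset.sum_congr rfl fun j _ => ?_
    rw [mul_add, expTwoPiI_add]; ring

theorem conj (hP : IsPhase N d B P) : IsPhase N d B (fun n => starRingEnd ℂ (P n)) := by
  obtain ⟨u, hu, hPu, hB⟩ := hP
  refine ⟨fun n i => (starRingEnd ℂ (u n i).1, -(u n i).2), fun n i => ?_, fun n => ?_,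
    (card_breakSet_le (fun n hn => by simp only [hn]) N).trans hB⟩
  · simpa using hu n i
  · simp [phaseSum, hPu, conj_expTwoPiI]

/-- Amplitudes are capped at `1`, so a larger constant is spread equally over `d` terms of frequency
zero. -/
theorem const_of_le {z : ℂ} (hz : ‖z‖ ≤ d) (N B : ℕ) : IsPhase N d B (fun _ => z) := by
  rcases Nat.eq_zero_or_pos d with rfl | hd
  · have : z = 0 := by simpa using hz
    subst this
    exact ⟨fun _ _ => (0, 0), by simp, by simp [phaseSum],
      (card_breakSet_const _ _).le.trans (Nat.zero_le _)⟩
  · have hd' : (0 : ℝ) < d := by exact_mod_cast hd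
    refine ⟨fun _ _ => (z / d, 0), fun n i => ?_, fun n => ?_,
      (card_breakSet_const _ _).le.trans (Nat.zero_le _)⟩
    · simpa [div_le_one hd'] using hz
    · have : (d : ℂ) ≠ 0 := by exact_mod_cast hd.ne'
      simp [phaseSum, expTwoPiI_zero]
      field_simp

theorem mono_terms (hP : IsPhase N d B P) (h : d ≤ d') : IsPhase N d' B P := by
  have h0 : IsPhase N (d' - d) 0 (fun _ => 0) := const_of_le (by simp) _ _
  have := hP.add h0
  rw [Nat.add_sub_cancel' h] at this
  simpa using this

theorem smul {z : ℂ} (hz : ‖z‖ ≤ 1) (hP : IsPhase N d B P) :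
    IsPhase N d B (fun n => z * P n) := by
  simpa using (const_of_le (d := 1) (by simpa using hz) N 0).mul hP

theorem re (hP : IsPhase N d B P) : IsPhase N (d + d) (B + B) (fun n => ((P n).re : ℂ)) := by
  have h := (hP.add hP.conj).smul (z := 1 / 2) (by norm_num)
  have h2 : (fun n => (1 / 2 : ℂ) * (P n + starRingEnd ℂ (P n))) = fun n => ((P n).re : ℂ) := by
    ext n
    rw [Complex.add_conj]
    push_cast; ring
  rwa [h2] at h

/-- The point is uniformity: `d'` and `C` depend on `p` and `d` alone, so the complexity can be
bounded before `N` and the phase sum are known. -/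
theorem polynomial_eval (p : Polynomial ℂ) (d : ℕ) :
    ∃ d' C : ℕ, ∀ (N B : ℕ) (P : ℕ → ℂ), IsPhase N d B P →
      IsPhase N d' (C * B) (fun n => p.eval (P n)) := by
  induction p using Polynomial.induction_on' with
  | add p q hp hq =>
    obtain ⟨d₁, C₁, h₁⟩ := hp
    obtain ⟨d₂, C₂, h₂⟩ := hq
    refine ⟨d₁ + d₂, C₁ + C₂, fun N B P hP => ?_⟩
    simpa [add_mul] using (h₁ N B P hP).add (h₂ N B P hP)
  | monomial k a =>
    have hpow : ∀ k : ℕ, ∃ d' C : ℕ, ∀ (N B : ℕ) (P : ℕ → ℂ), IsPhase N d B P →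
        IsPhase N d' (C * B) (fun n => P n ^ k) := by
      intro k
      induction k with
      | zero => exact ⟨1, 0, fun N B P _ => by simpa using const_of_le (d := 1) (by simp) N 0⟩
      | succ k ih =>
        obtain ⟨d₁, C₁, h₁⟩ := ih
        refine ⟨d₁ * d, C₁ + 1, fun N B P hP => ?_⟩
        simpa [add_mul, pow_succ] using (h₁ N B P hP).mul hP
    obtain ⟨d₁, C₁, h₁⟩ := hpow k
    refine ⟨⌈‖a‖⌉₊ * d₁, C₁, fun N B P hP => ?_⟩
    simpa using (const_of_le (Nat.le_ceil ‖a‖) N 0).mul (h₁ N B P hP)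

theorem norm_le (hP : IsPhase N d B P) (n : ℕ) : ‖P n‖ ≤ d := by
  obtain ⟨u, hu, hPu, -⟩ := hP
  rw [hPu, phaseSum]
  refine (norm_sum_le _ _).trans ?_
  calc _ ≤ ∑ _i : Fin d, (1 : ℝ) := Finset.sum_le_sum fun i _ => by
        rw [norm_mul, norm_expTwoPiI, mul_one]; exact hu n i
    _ = d := by simp

end IsPhase

/-! ### Truncation and Weierstrass approximation. -/

/-- Truncation of a real number to `[0, 1]`. -/
def clamp (x : ℝ) : ℝ := max 0 (min 1 x)

theorem clamp_nonneg (x : ℝ) : 0 ≤ clamp x := le_max_left _ _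

theorem clamp_le_one (x : ℝ) : clamp x ≤ 1 := max_le zero_le_one (min_le_left _ _)

theorem continuous_clamp : Continuous clamp := by unfold clamp; fun_prop

theorem abs_sub_clamp_le {a x : ℝ} (h0 : 0 ≤ a) (h1 : a ≤ 1) : |a - clamp x| ≤ |a - x| := by
  unfold clamp
  rcases le_total x 0 with hx | hx <;> rcases le_total x 1 with hx' | hx' <;>
  simp only [min_eq_left, min_eq_right, max_eq_left, max_eq_right, hx, hx', zero_le_one] <;>
  rw [← sq_le_sq] <;> nlinarith

/-- Truncations of real parts of phase sums are uniformly close to phase sums of bounded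
complexity. -/
theorem exists_isPhase_near_clamp (d : ℕ) {η : ℝ} (hη : 0 < η) :
    ∃ d' C : ℕ, ∀ (N B : ℕ) (P : ℕ → ℂ), IsPhase N d B P →
      ∃ G, IsPhase N d' (C * B) G ∧ ∀ n, ‖(clamp (P n).re : ℂ) - G n‖ ≤ η := by
  -- A sum of `d` phases is bounded by `d`, so approximation on `[-d, d]` suffices.
  obtain ⟨p, hp⟩ := exists_polynomial_near_of_continuousOn (-(d : ℝ)) d clamp
    continuous_clamp.continuousOn η hη
  obtain ⟨d', C, h⟩ := IsPhase.polynomial_eval (p.map Complex.ofRealHom) (d + d)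
  refine ⟨d', 2 * C, fun N B P hP => ⟨fun n => ((p.eval (P n).re : ℝ) : ℂ), ?_, fun n => ?_⟩⟩
  · have := h N (B + B) _ hP.re
    have hB : C * (B + B) = 2 * C * B := by ring
    rw [hB] at this
    have he : ∀ x : ℝ, (p.map Complex.ofRealHom).eval (x : ℂ) = ((p.eval x : ℝ) : ℂ) := fun x => by
      have := Polynomial.eval_map_apply (p := p) (f := Complex.ofRealHom) x
      simpa using this
    simpa only [he] using this
  · rw [← Complex.ofReal_sub, Complex.norm_real, Real.norm_eq_abs, abs_sub_comm]
    have hre := (Complex.abs_re_le_norm (P n)).trans (hP.norm_le n)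
    exact (hp _ (by rw [abs_le] at hre; exact hre)).le

/-! ### Mean squares and the least approximation error. -/

/-- The mean square of `F` over `{1, …, N}`. -/
def msq (N : ℕ) (F : ℕ → ℂ) : ℝ := (1 / (N : ℝ)) * ∑ n ∈ Finset.Icc 1 N, ‖F n‖ ^ 2

theorem msq_nonneg (N : ℕ) (F : ℕ → ℂ) : 0 ≤ msq N F := by unfold msq; positivity

theorem msq_mono {N : ℕ} {F G : ℕ → ℂ} (h : ∀ n, ‖F n‖ ≤ ‖G n‖) : msq N F ≤ msq N G := by
  unfold msq
  gcongr with n _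
  exact h n

theorem msq_le_of_norm_le {N : ℕ} {F : ℕ → ℂ} {b : ℝ} (h : ∀ n, ‖F n‖ ≤ b) :
    msq N F ≤ b ^ 2 := by
  rcases Nat.eq_zero_or_pos N with rfl | hN
  · simp [msq]; positivity
  · have hN' : (0 : ℝ) < N := by exact_mod_cast hN
    rw [msq, one_div, inv_mul_le_iff₀ hN']
    calc _ ≤ ∑ _n ∈ Finset.Icc 1 N, b ^ 2 := Finset.sum_le_sum fun n _ => by gcongr; exact h n
      _ = _ := by simp

theorem msq_parallelogram (N : ℕ) (F G : ℕ → ℂ) :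
    msq N (fun n => F n - G n) = 2 * msq N F + 2 * msq N G
      - 4 * msq N (fun n => (F n + G n) / 2) := by
  simp only [msq, Finset.mul_sum, ← Finset.sum_add_distrib, ← Finset.sum_sub_distrib]
  refine Finset.sum_congr rfl fun n _ => ?_
  have := parallelogram_law_with_norm ℝ (F n) (G n)
  rw [norm_div, div_pow]
  simp only [Complex.norm_ofNat]
  rw [sub_eq_add_neg] at this ⊢
  linear_combination (1 / (N : ℝ)) * this

/-- From `2η‖G‖ ≤ η‖G‖² + η`; the bound `2` on the mean square of `G` turns the multiplicative loss
into `4η`. -/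
theorem msq_le_of_near {N : ℕ} {F G : ℕ → ℂ} {η : ℝ} (h0 : 0 < η) (h1 : η ≤ 1)
    (h : ∀ n, ‖F n - G n‖ ≤ η) (hG : msq N G ≤ 2) : msq N F ≤ msq N G + 4 * η := by
  have hpt : ∀ n, ‖F n‖ ^ 2 ≤ (1 + η) * ‖G n‖ ^ 2 + (η ^ 2 + η) := fun n => by
    have h2 : ‖F n‖ ≤ ‖G n‖ + η := by
      have := norm_add_le (F n - G n) (G n)
      rw [sub_add_cancel] at this
      linarith [h n]
    have := norm_nonneg (G n)
    calc ‖F n‖ ^ 2 ≤ (‖G n‖ + η) ^ 2 := by gcongr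
      _ ≤ _ := by nlinarith [mul_nonneg h0.le (sq_nonneg (‖G n‖ - 1))]
  have h3 : msq N F ≤ (1 + η) * msq N G + (η ^ 2 + η) := by
    rcases Nat.eq_zero_or_pos N with rfl | hN
    · simp [msq]; positivity
    · have hN' : (0 : ℝ) < N := by exact_mod_cast hN
      rw [msq, one_div, inv_mul_le_iff₀ hN']
      refine (Finset.sum_le_sum fun n _ => hpt n).trans (le_of_eq ?_)
      rw [Finset.sum_add_distrib, ← Finset.mul_sum, msq]
      simp
      field_simp
  nlinarith

/-- The least mean square error in approximating `f` on `{1, …, N}` by phase sums. -/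
def bestErr (f : ℕ → ℝ) (N d B : ℕ) : ℝ :=
  sInf {e | ∃ P, IsPhase N d B P ∧ e = msq N (fun n => (f n : ℂ) - P n)}

section bestErr

variable {f : ℕ → ℝ} {N d d' B B' : ℕ} {P : ℕ → ℂ}

theorem bestErr_le (hP : IsPhase N d B P) :
    bestErr f N d B ≤ msq N (fun n => (f n : ℂ) - P n) :=
  csInf_le ⟨0, by rintro _ ⟨P, -, rfl⟩; exact msq_nonneg _ _⟩ ⟨P, hP, rfl⟩

theorem bestErr_set_nonempty (f : ℕ → ℝ) (N d B : ℕ) :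
    {e | ∃ P, IsPhase N d B P ∧ e = msq N (fun n => (f n : ℂ) - P n)}.Nonempty :=
  ⟨_, _, IsPhase.const_of_le (z := 0) (by simp) _ _, rfl⟩

theorem exists_lt_bestErr_add (f : ℕ → ℝ) (N d B : ℕ) {δ : ℝ} (hδ : 0 < δ) :
    ∃ P, IsPhase N d B P ∧ msq N (fun n => (f n : ℂ) - P n) ≤ bestErr f N d B + δ := by
  obtain ⟨e, ⟨P, hP, rfl⟩, he⟩ := exists_lt_of_csInf_lt (bestErr_set_nonempty f N d B)
    (lt_add_of_pos_right (bestErr f N d B) hδ)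
  exact ⟨P, hP, he.le⟩

theorem bestErr_nonneg (f : ℕ → ℝ) (N d B : ℕ) : 0 ≤ bestErr f N d B :=
  le_csInf (bestErr_set_nonempty f N d B) (by rintro _ ⟨P, -, rfl⟩; exact msq_nonneg _ _)

theorem bestErr_le_one (hf : ∀ n, 0 ≤ f n ∧ f n ≤ 1) (N d B : ℕ) : bestErr f N d B ≤ 1 := by
  refine (bestErr_le (IsPhase.const_of_le (z := 0) (by simp) _ _)).trans ?_
  refine (msq_le_of_norm_le (b := 1) fun n => ?_).trans (by norm_num)
  simpa [abs_of_nonneg (hf n).1] using (hf n).2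

theorem bestErr_antitone (hd : d ≤ d') (hB : B ≤ B') : bestErr f N d' B' ≤ bestErr f N d B :=
  le_csInf (bestErr_set_nonempty f N d B) (by
    rintro _ ⟨P, hP, rfl⟩
    exact bestErr_le ((hP.mono_terms hd).mono_breaks hB))

end bestErr

/-! ### Fourier analysis and the `U²` inverse theorem on intervals. -/

section GowersInverse

variable {M : ℕ} [NeZero M]

/-- The unnormalised Fourier transform on `ZMod M`. -/
def fourierSum (g : ZMod M → ℂ) (ξ : ZMod M) : ℂ := ∑ a, g a * ZMod.stdAddChar (ξ * a)

theorem conj_stdAddChar (a : ZMod M) :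
    starRingEnd ℂ (ZMod.stdAddChar a) = ZMod.stdAddChar (-a) := by
  rw [ZMod.stdAddChar_apply, ZMod.stdAddChar_apply, AddChar.map_neg_eq_inv, Circle.coe_inv_eq_conj]

theorem sum_norm_sq_fourierSum (g : ZMod M → ℂ) :
    ∑ ξ, ‖fourierSum g ξ‖ ^ 2 = M * ∑ a, ‖g a‖ ^ 2 := by
  have hC : ((∑ ξ, ‖fourierSum g ξ‖ ^ 2 : ℝ) : ℂ) = ((M * ∑ a, ‖g a‖ ^ 2 : ℝ) : ℂ) := by
    push_cast
    simp only [← Complex.mul_conj', fourierSum, map_sum, Finset.sum_mul_sum, map_mul,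
      conj_stdAddChar]
    rw [Finset.sum_comm, Finset.mul_sum]
    refine Finset.sum_congr rfl fun a _ => ?_
    rw [Finset.sum_comm]
    have h : ∀ b, ∑ ξ : ZMod M, g a * ZMod.stdAddChar (ξ * a) *
        (starRingEnd ℂ (g b) * ZMod.stdAddChar (-(ξ * b))) =
        if a - b = 0 then M * (g a * starRingEnd ℂ (g b)) else 0 := fun b => by
      have h1 := AddChar.sum_mulShift (a - b) (ZMod.isPrimitive_stdAddChar M)
      rw [ZMod.card] at h1
      calc _ = (g a * starRingEnd ℂ (g b)) *
            ∑ ξ : ZMod M, ZMod.stdAddChar (ξ * (a - b)) := by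
            rw [Finset.mul_sum]
            refine Finset.sum_congr rfl fun ξ _ => ?_
            rw [mul_sub, sub_eq_add_neg, AddChar.map_add_eq_mul]; ring
        _ = _ := by rw [h1]; split_ifs <;> simp [mul_comm]
    simp only [h, sub_eq_zero, Finset.sum_ite_eq, Finset.mem_univ, if_true]
  exact_mod_cast hC

/-- The Gowers sum is the square sum of the autocorrelation `A`, whose Fourier transform is `|ĝ|²`;
Parseval for `A` gives the fourth powers. -/
theorem gowersU2_pow_four (g : ZMod M → ℂ) :
    gowersU2 g ^ 4 = (1 / (M : ℝ) ^ 4) * ∑ ξ, ‖fourierSum g ξ‖ ^ 4 := by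
  have hM : (M : ℝ) ≠ 0 := by exact_mod_cast NeZero.ne M
  set A : ZMod M → ℂ := fun h => ∑ x, g (x + h) * starRingEnd ℂ (g x) with hA
  have hS : ∀ ξ, fourierSum A ξ = fourierSum g ξ * starRingEnd ℂ (fourierSum g ξ) := fun ξ => by
    simp only [fourierSum, hA, map_sum, map_mul, conj_stdAddChar, Finset.sum_mul,
      Finset.mul_sum]
    rw [Finset.sum_comm]
    refine Finset.sum_congr rfl fun x _ => ?_
    rw [← Equiv.sum_comp (Equiv.addLeft x)
      (fun i => g i * ZMod.stdAddChar (ξ * i) *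
        (starRingEnd ℂ (g x) * ZMod.stdAddChar (-(ξ * x))))]
    refine Finset.sum_congr rfl fun h _ => ?_
    have : (ZMod.stdAddChar (ξ * h) : ℂ) =
        ZMod.stdAddChar (ξ * (x + h)) * ZMod.stdAddChar (-(ξ * x)) := by
      rw [← AddChar.map_add_eq_mul]; congr 1; ring
    simp only [Equiv.coe_addLeft]
    rw [this]; ring
  have hT : ∑ x, ∑ h₁, ∑ h₂, g x * starRingEnd ℂ (g (x + h₁)) * starRingEnd ℂ (g (x + h₂)) *
      g (x + h₁ + h₂) = ((∑ h, ‖A h‖ ^ 2 : ℝ) : ℂ) := by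
    push_cast
    rw [Finset.sum_comm]
    refine Finset.sum_congr rfl fun h _ => ?_
    rw [← Complex.conj_mul']
    simp only [hA, map_sum, map_mul, Complex.conj_conj, Finset.sum_mul]
    refine Finset.sum_congr rfl fun x _ => ?_
    rw [Finset.mul_sum, ← Equiv.sum_comp (Equiv.addLeft x)
      (fun y => starRingEnd ℂ (g (x + h)) * g x * (g (y + h) * starRingEnd ℂ (g y)))]
    refine Finset.sum_congr rfl fun k _ => ?_
    simp only [Equiv.coe_addLeft]
    rw [add_right_comm x h k]; ring
  have h4 : ∑ ξ, ‖fourierSum g ξ‖ ^ 4 = M * ∑ h, ‖A h‖ ^ 2 := by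
    rw [← sum_norm_sq_fourierSum]
    refine Finset.sum_congr rfl fun ξ _ => ?_
    rw [hS, norm_mul, RCLike.norm_conj]; ring
  rw [gowersU2, hT, ← Real.rpow_natCast, ← Real.rpow_mul (norm_nonneg _), h4, ZMod.card, norm_mul,
    Complex.norm_real, Real.norm_eq_abs, abs_of_nonneg (by positivity)]
  norm_num
  field_simp

/-- Take the largest Fourier coefficient out of the sum of fourth powers and apply Parseval to the
rest. -/
theorem exists_gowersU2_pow_four_le (g : ZMod M → ℂ) :
    ∃ ξ, gowersU2 g ^ 4 ≤ (1 / (M : ℝ) ^ 3) * ‖fourierSum g ξ‖ ^ 2 * ∑ a, ‖g a‖ ^ 2 := by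
  have hM : (0 : ℝ) < M := by exact_mod_cast NeZero.pos M
  obtain ⟨ξ, hξ⟩ := Finite.exists_max fun ξ => ‖fourierSum g ξ‖
  refine ⟨ξ, ?_⟩
  have h : ∑ η, ‖fourierSum g η‖ ^ 4 ≤ ‖fourierSum g ξ‖ ^ 2 * (M * ∑ a, ‖g a‖ ^ 2) := by
    rw [← sum_norm_sq_fourierSum, Finset.mul_sum]
    refine Finset.sum_le_sum fun η _ => ?_
    have := hξ η
    calc _ = ‖fourierSum g η‖ ^ 2 * ‖fourierSum g η‖ ^ 2 := by ring
      _ ≤ _ := by gcongr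
  rw [gowersU2_pow_four]
  calc _ ≤ (1 / (M : ℝ) ^ 4) * (‖fourierSum g ξ‖ ^ 2 * (M * ∑ a, ‖g a‖ ^ 2)) := by gcongr
    _ = _ := by field_simp

end GowersInverse

theorem sum_zmod_val {E : Type*} [AddCommMonoid E] (M : ℕ) [NeZero M] (φ : ℕ → E) :
    ∑ a : ZMod M, φ a.val = ∑ n ∈ Finset.range M, φ n := by
  rw [Finset.sum_range]
  cases M with
  | zero => exact absurd rfl (NeZero.ne 0)
  | succ k => rfl

theorem sum_zmod_four_mul {E : Type*} [AddCommMonoid E] (L : ℕ+) (φ : ℕ → E) :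
    ∑ a : ZMod (4 * (L : ℕ)), (if 1 ≤ a.val ∧ a.val ≤ (L : ℕ) then φ a.val else 0) =
      ∑ m ∈ Finset.range L, φ (m + 1) := by
  have hL := L.pos
  have h2 : 4 * (L : ℕ) = (L + 1) + (3 * L - 1) := by omega
  rw [sum_zmod_val (4 * (L : ℕ)) fun n => if 1 ≤ n ∧ n ≤ (L : ℕ) then φ n else 0, h2,
    Finset.sum_range_add, Finset.sum_range_succ', if_neg (by omega), add_zero,
    Finset.sum_eq_zero (s := Finset.range (3 * L - 1)) fun n _ => if_neg (by omega), add_zero]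
  refine Finset.sum_congr rfl fun m hm => if_pos ?_
  have := Finset.mem_range.1 hm
  omega

theorem stdAddChar_mul_natCast {M : ℕ} [NeZero M] (ξ : ZMod M) (m : ℕ) :
    (ZMod.stdAddChar (ξ * (m : ZMod M)) : ℂ) = expTwoPiI (m * (ξ.val / M)) := by
  have : ξ * (m : ZMod M) = ((ξ.val * m : ℕ) : ZMod M) := by
    push_cast; rw [ZMod.natCast_zmod_val]
  rw [this, ZMod.stdAddChar_apply, ZMod.toCircle_natCast, expTwoPiI]
  congr 1; push_cast; ring

theorem fourierSum_cyclicLift (F : ℕ → ℂ) (x : ℕ) (L : ℕ+) (ξ : ZMod (4 * (L : ℕ))) :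
    fourierSum (cyclicLift F x L) ξ = ∑ m ∈ Finset.range L, F (x + (m + 1)) *
      expTwoPiI ((m + 1 : ℕ) * (ξ.val / (4 * L : ℕ))) := by
  rw [← sum_zmod_four_mul L
    (fun n => F (x + n) * expTwoPiI ((n : ℕ) * (ξ.val / (4 * L : ℕ))))]
  refine Finset.sum_congr rfl fun a _ => ?_
  have := stdAddChar_mul_natCast ξ a.val
  rw [ZMod.natCast_zmod_val] at this
  rw [cyclicLift, this]
  split_ifs <;> simp

/-- The correlation of `F` with `e(n β)` on the window `{x + 1, …, x + L}`. -/
def localCorr (F : ℕ → ℂ) (L : ℕ) (β : ℝ) (x : ℕ) : ℂ :=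
  (1 / (L : ℂ)) * ∑ m ∈ Finset.range L, F (x + m + 1) * expTwoPiI (((x + m + 1 : ℕ) : ℝ) * -β)

theorem norm_localCorr_le {F : ℕ → ℂ} (hF : ∀ n, ‖F n‖ ≤ 1) (L : ℕ) (β : ℝ) (x : ℕ) :
    ‖localCorr F L β x‖ ≤ 1 := by
  rw [localCorr, norm_mul]
  have h : ‖∑ m ∈ Finset.range L, F (x + m + 1) * expTwoPiI (((x + m + 1 : ℕ) : ℝ) * -β)‖ ≤ L := by
    refine (norm_sum_le _ _).trans ?_
    calc _ ≤ ∑ _m ∈ Finset.range L, (1 : ℝ) := Finset.sum_le_sum fun m _ => by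
          rw [norm_mul, norm_expTwoPiI, mul_one]; exact hF _
      _ = L := by simp
  calc _ ≤ ‖1 / (L : ℂ)‖ * L := by gcongr
    _ ≤ 1 := by
      rw [norm_div, norm_one, Complex.norm_natCast]
      rw [one_div]
      exact inv_mul_le_one

/-- The zero frequency alone contributes `(L / 4L)⁴`. -/
theorem le_gowersU2_cyclicLift_one_pow_four (L : ℕ+) :
    1 / 256 ≤ gowersU2 (cyclicLift (fun _ => 1) 0 L) ^ 4 := by
  have hL : (0 : ℝ) < (L : ℕ) := by exact_mod_cast L.pos
  rw [gowersU2_pow_four]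
  have h0 : fourierSum (cyclicLift (fun _ => 1) 0 L) 0 = (L : ℕ) := by
    rw [fourierSum_cyclicLift]
    simp [expTwoPiI_zero]
  have h1 := Finset.single_le_sum (f := fun ξ => ‖fourierSum (cyclicLift (fun _ => 1) 0 L) ξ‖ ^ 4)
    (fun ξ _ => by positivity) (Finset.mem_univ 0)
  simp only [h0, Complex.norm_natCast] at h1
  calc (1 : ℝ) / 256 = (1 / ((4 * (L : ℕ) : ℕ) : ℝ) ^ 4) * ((L : ℕ) : ℝ) ^ 4 := by
        push_cast; field_simp; norm_num
    _ ≤ _ := by gcongr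

/-- With modulus `4L` and energy at most `L`, the fourth power of the unnormalised norm is at most
`1/64` of the squared correlation; the normalisation costs at most a factor `256`. -/
theorem exists_gowersU2Interval_pow_four_le {F : ℕ → ℂ} (hF : ∀ n, ‖F n‖ ≤ 1) (x : ℕ) (L : ℕ+) :
    ∃ β : ℝ, gowersU2Interval F x L ^ 4 ≤ 4 * ‖localCorr F L β x‖ ^ 2 := by
  have hL : (0 : ℝ) < (L : ℕ) := by exact_mod_cast L.pos
  obtain ⟨ξ, hξ⟩ := exists_gowersU2_pow_four_le (cyclicLift F x L)
  refine ⟨-(ξ.val / (4 * L : ℕ)), ?_⟩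
  have h1 : ∑ a, ‖cyclicLift F x L a‖ ^ 2 ≤ (L : ℕ) := by
    calc _ ≤ ∑ a : ZMod (4 * (L : ℕ)), (if 1 ≤ a.val ∧ a.val ≤ (L : ℕ) then (1 : ℝ) else 0) := by
          refine Finset.sum_le_sum fun a _ => ?_
          rw [cyclicLift]
          split_ifs
          · exact pow_le_one₀ (norm_nonneg _) (hF _)
          · simp
      _ = _ := by rw [sum_zmod_four_mul L fun _ => (1 : ℝ)]; simp
  have h2 : ‖localCorr F L (-(ξ.val / (4 * L : ℕ))) x‖ =
      (1 / ((L : ℕ) : ℝ)) * ‖fourierSum (cyclicLift F x L) ξ‖ := by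
    have : localCorr F L (-(ξ.val / (4 * L : ℕ))) x = (1 / ((L : ℕ) : ℂ)) *
        (expTwoPiI (x * (ξ.val / (4 * L : ℕ))) * fourierSum (cyclicLift F x L) ξ) := by
      rw [localCorr, fourierSum_cyclicLift, Finset.mul_sum (a := expTwoPiI _)]
      refine congrArg _ ?_
      refine Finset.sum_congr rfl fun m _ => ?_
      rw [← add_assoc, mul_left_comm, ← expTwoPiI_add]
      congr 2
      push_cast; ring
    rw [this, norm_mul, norm_mul, norm_expTwoPiI, one_mul]
    simp
  have h3 := le_gowersU2_cyclicLift_one_pow_four L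
  have h4 : gowersU2 (cyclicLift F x L) ^ 4 ≤
      (1 / ((4 * (L : ℕ) : ℕ) : ℝ) ^ 3) * ‖fourierSum (cyclicLift F x L) ξ‖ ^ 2 * (L : ℕ) :=
    hξ.trans (by gcongr)
  rw [gowersU2Interval, div_pow, div_le_iff₀ (by linarith), h2]
  calc _ ≤ _ := h4
    _ = 4 * (1 / ((L : ℕ) : ℝ) * ‖fourierSum (cyclicLift F x L) ξ‖) ^ 2 * (1 / 256) := by
      push_cast; field_simp; ring
    _ ≤ _ := by gcongr

theorem gowersU2Interval_nonneg (F : ℕ → ℂ) (x : ℕ) (L : ℕ+) : 0 ≤ gowersU2Interval F x L := by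
  unfold gowersU2Interval gowersU2
  positivity

theorem gowersU2Interval_congr {F G : ℕ → ℂ} {x : ℕ} {L : ℕ+}
    (h : ∀ n, x < n → n ≤ x + L → F n = G n) : gowersU2Interval F x L = gowersU2Interval G x L := by
  have : cyclicLift F x L = cyclicLift G x L := by
    funext a
    unfold cyclicLift
    split_ifs with ha
    · exact h _ (by omega) (by omega)
    · rfl
  rw [gowersU2Interval, gowersU2Interval, this]

theorem gowersU2Interval_le_two {F : ℕ → ℂ} (hF : ∀ n, ‖F n‖ ≤ 1) (x : ℕ) (L : ℕ+) :
    gowersU2Interval F x L ≤ 2 := by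
  obtain ⟨β, hβ⟩ := exists_gowersU2Interval_pow_four_le hF x L
  have h1 := norm_localCorr_le hF L β x
  have h2 : ‖localCorr F L β x‖ ^ 2 ≤ 1 := pow_le_one₀ (norm_nonneg _) h1
  exact le_of_pow_le_pow_left₀ four_ne_zero zero_le_two (by linarith)

/-! ### Local correlations as gains in mean square. -/

section Blocks

variable {N H : ℕ} {F : ℕ → ℂ}

theorem sum_range_mul {E : Type*} [AddCommMonoid E] (φ : ℕ → E) (Q H : ℕ) :
    ∑ n ∈ Finset.range (Q * H), φ n =
      ∑ q ∈ Finset.range Q, ∑ m ∈ Finset.range H, φ (q * H + m) := by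
  induction Q with
  | zero => simp
  | succ Q ih => rw [add_mul, one_mul, Finset.sum_range_add, ih, Finset.sum_range_succ]

/-- Removing from `F` its projection to a phase on a window lowers the square sum by the square
of the correlation. -/
theorem sum_sub_phase (F : ℕ → ℂ) (hH : 0 < H) (β : ℝ) (x : ℕ) :
    ∑ m ∈ Finset.range H, (‖F (x + m + 1)‖ ^ 2 -
      ‖F (x + m + 1) - localCorr F H β x * expTwoPiI (((x + m + 1 : ℕ) : ℝ) * β)‖ ^ 2) =
      H * ‖localCorr F H β x‖ ^ 2 := by
  have hH' : (H : ℂ) ≠ 0 := by exact_mod_cast hH.ne'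
  set c := localCorr F H β x with hc
  have hsum : ∑ m ∈ Finset.range H, F (x + m + 1) * expTwoPiI (((x + m + 1 : ℕ) : ℝ) * -β) =
      H * c := by rw [hc, localCorr, one_div, mul_inv_cancel_left₀ hH']
  have hpt : ∀ m, ((‖F (x + m + 1)‖ ^ 2 -
      ‖F (x + m + 1) - c * expTwoPiI (((x + m + 1 : ℕ) : ℝ) * β)‖ ^ 2 : ℝ) : ℂ) =
      starRingEnd ℂ c * (F (x + m + 1) * expTwoPiI (((x + m + 1 : ℕ) : ℝ) * -β)) +
      c * starRingEnd ℂ (F (x + m + 1) * expTwoPiI (((x + m + 1 : ℕ) : ℝ) * -β)) -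
      c * starRingEnd ℂ c := fun m => by
    have h1 : expTwoPiI (((x + m + 1 : ℕ) : ℝ) * β) * expTwoPiI (((x + m + 1 : ℕ) : ℝ) * -β) = 1 := by
      rw [← expTwoPiI_add, ← mul_add, add_neg_cancel, mul_zero, expTwoPiI_zero]
    push_cast
    rw [← Complex.mul_conj', ← Complex.mul_conj']
    simp only [map_sub, map_mul, conj_expTwoPiI, mul_neg, neg_neg] at h1 ⊢
    push_cast at h1 ⊢
    linear_combination (-c * starRingEnd ℂ c) * h1
  have hC : ((∑ m ∈ Finset.range H, (‖F (x + m + 1)‖ ^ 2 -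
      ‖F (x + m + 1) - c * expTwoPiI (((x + m + 1 : ℕ) : ℝ) * β)‖ ^ 2) : ℝ) : ℂ) =
      ((H * ‖c‖ ^ 2 : ℝ) : ℂ) := by
    rw [Complex.ofReal_sum, Finset.sum_congr rfl fun m _ => hpt m, Finset.sum_sub_distrib,
      Finset.sum_add_distrib, ← Finset.mul_sum, ← Finset.mul_sum, ← map_sum, hsum]
    push_cast
    rw [← Complex.mul_conj']
    simp
    ring
  exact_mod_cast hC

/-- The data of the best approximation of `F` by multiples of `e(n β_x)` on each of the windows
`{x + 1, …, x + H} ⊆ {1, …, N}` with `x ≡ ρ` modulo `H`. -/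
def blockData (F : ℕ → ℂ) (N H ρ : ℕ) (β : ℕ → ℝ) (n : ℕ) : Fin 1 → ℂ × ℝ := fun _ =>
  if n ≤ ρ then (0, 0) else
    if ρ + (n - ρ - 1) / H * H + H ≤ N then
      (localCorr F H (β (ρ + (n - ρ - 1) / H * H)) (ρ + (n - ρ - 1) / H * H),
        β (ρ + (n - ρ - 1) / H * H))
    else (0, 0)

theorem isPhase_blockData (hF : ∀ n, ‖F n‖ ≤ 1) (ρ : ℕ) (β : ℕ → ℝ) :
    IsPhase N 1 (N / H + 1) (phaseSum (blockData F N H ρ β)) := by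
  refine ⟨_, fun n i => ?_, fun n => rfl, ?_⟩
  · unfold blockData
    split_ifs
    · simp
    · exact norm_localCorr_le hF _ _ _
    · simp
  · have hsub : breakSet (blockData F N H ρ β) N ⊆
        (Finset.range (N / H + 1)).image fun q => ρ + q * H := by
      intro n hn
      simp only [breakSet, Finset.mem_filter, Finset.mem_range] at hn
      by_contra hc
      refine hn.2 (funext fun i => ?_)
      rcases lt_or_ge n ρ with h | h
      · simp [blockData, h.le, Nat.succ_le_of_lt h]
      · have hdvd : ¬ H ∣ n - ρ := by
          rintro ⟨q, hq⟩
          refine hc (Finset.mem_image.2 ⟨(n - ρ) / H, ?_, ?_⟩)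
          · exact Finset.mem_range.2 (Nat.lt_succ_of_le (Nat.div_le_div_right (by omega)))
          · show ρ + (n - ρ) / H * H = n
            rw [Nat.div_mul_cancel ⟨q, hq⟩]; omega
        have hlt : ρ < n := by
          rcases h.lt_or_eq with h | h
          · exact h
          · exact absurd (by simp [h]) hdvd
        have hdiv : (n + 1 - ρ - 1) / H = (n - ρ - 1) / H := by
          have := Nat.succ_div (a := n - ρ - 1) (b := H)
          rw [Nat.sub_add_cancel (by omega), if_neg hdvd] at this
          rw [show n + 1 - ρ - 1 = n - ρ by omega, this, add_zero]
        simp only [blockData, hdiv, if_neg (not_le.2 hlt), if_neg (show ¬ n + 1 ≤ ρ by omega)]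
    refine (Finset.card_le_card hsub).trans (Finset.card_image_le.trans ?_)
    simp

theorem sum_sub_blockData (F : ℕ → ℂ) (N : ℕ) (hH : 0 < H) (ρ : ℕ) (β : ℕ → ℝ) :
    ∑ n ∈ Finset.range N, (‖F (n + 1)‖ ^ 2 -
      ‖F (n + 1) - phaseSum (blockData F N H ρ β) (n + 1)‖ ^ 2) =
    ∑ q ∈ Finset.range N, H * (if ρ + q * H + H ≤ N then
      ‖localCorr F H (β (ρ + q * H)) (ρ + q * H)‖ ^ 2 else 0) := by
  set D : ℕ → ℝ := fun n => ‖F (n + 1)‖ ^ 2 -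
      ‖F (n + 1) - phaseSum (blockData F N H ρ β) (n + 1)‖ ^ 2 with hD
  have hzero : ∀ n, blockData F N H ρ β (n + 1) 0 = (0, 0) → D n = 0 := fun n hn => by
    simp [hD, phaseSum, hn]
  -- The range is lengthened to consist of the first `ρ` points and `N` whole blocks; beyond `N` the
  -- block data vanish, so nothing is added.
  have h1 : ∑ n ∈ Finset.range (ρ + N * H), D n = ∑ n ∈ Finset.range N, D n := by
    have hle : N ≤ ρ + N * H := by nlinarith
    rw [← Nat.add_sub_cancel' hle, Finset.sum_range_add,
      Finset.sum_eq_zero (s := Finset.range (ρ + N * H - N)), add_zero]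
    intro k _
    refine hzero _ ?_
    unfold blockData
    split_ifs with h2 h3
    · rfl
    · have := Nat.lt_div_mul_add (a := N + k + 1 - ρ - 1) hH
      omega
    · rfl
  rw [← h1, Finset.sum_range_add, Finset.sum_eq_zero fun n hn => ?_, zero_add, sum_range_mul]
  · refine Finset.sum_congr rfl fun q _ => ?_
    have hq : ∀ m ∈ Finset.range H, (ρ + (q * H + m) + 1 - ρ - 1) / H = q := fun m hm => by
      rw [show ρ + (q * H + m) + 1 - ρ - 1 = m + H * q by rw [mul_comm H q]; omega,
        Nat.add_mul_div_left _ _ hH, Nat.div_eq_of_lt (Finset.mem_range.1 hm), zero_add]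
    split_ifs with h
    · rw [← sum_sub_phase F hH (β (ρ + q * H)) (ρ + q * H)]
      refine Finset.sum_congr rfl fun m hm => ?_
      have : blockData F N H ρ β (ρ + (q * H + m) + 1) 0 =
          (localCorr F H (β (ρ + q * H)) (ρ + q * H), β (ρ + q * H)) := by
        simp only [blockData, hq m hm, if_pos h, if_neg (show ¬ ρ + (q * H + m) + 1 ≤ ρ by omega)]
      rw [← add_assoc] at this
      simp only [hD, phaseSum, Finset.univ_unique, Fin.default_eq_zero, Finset.sum_singleton,
        ← add_assoc, this]
    · rw [mul_zero]
      refine Finset.sum_eq_zero fun m hm => hzero _ ?_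
      simp only [blockData, hq m hm, if_neg h, ite_self]
  · refine hzero _ ?_
    have := Finset.mem_range.1 hn
    simp [blockData, Nat.succ_le_of_lt this]

theorem msq_sub_msq (N : ℕ) (F G : ℕ → ℂ) : (N : ℝ) * (msq N F - msq N G) =
    ∑ n ∈ Finset.range N, (‖F (n + 1)‖ ^ 2 - ‖G (n + 1)‖ ^ 2) := by
  rcases Nat.eq_zero_or_pos N with rfl | hN
  · simp
  have hN' : (N : ℝ) ≠ 0 := by exact_mod_cast hN.ne'
  have h : ∀ φ : ℕ → ℝ, ∑ n ∈ Finset.Icc 1 N, φ n = ∑ n ∈ Finset.range N, φ (n + 1) := fun φ => by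
    rw [Finset.range_eq_Ico, Finset.sum_Ico_add' φ 0 N 1]
    rfl
  rw [msq, msq, ← mul_sub, ← Finset.sum_sub_distrib, ← mul_assoc, mul_one_div_cancel hN', one_mul,
    h]

/-- If no locally constant phase on the scale `H` correlates with `F`, then `F` has small
correlation with phases on most windows of length `H`. -/
theorem sum_localCorr_le (hF : ∀ n, ‖F n‖ ≤ 1) (hH : 0 < H) {κ : ℝ}
    (hκ : ∀ h, IsPhase N 1 (N / H + 1) h → msq N F ≤ msq N (fun n => F n - h n) + κ) (β : ℕ → ℝ) :
    ∑ x ∈ Finset.range (N + 1 - H), ‖localCorr F H (β x) x‖ ^ 2 ≤ N * κ := by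
  have hH' : (0 : ℝ) < H := by exact_mod_cast hH
  set v : ℕ → ℝ := fun x => if x + H ≤ N then ‖localCorr F H (β x) x‖ ^ 2 else 0 with hv
  have hv0 : ∀ x, 0 ≤ v x := fun x => by simp only [hv]; positivity
  have h1 : ∀ ρ, ∑ q ∈ Finset.range N, H * v (ρ + q * H) ≤ N * κ := fun ρ => by
    have h2 := hκ _ (isPhase_blockData hF ρ β)
    have h3 := sum_sub_blockData F N hH ρ β
    rw [← msq_sub_msq N F fun n => F n - phaseSum (blockData F N H ρ β) n] at h3
    simp only [hv]
    rw [← h3]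
    exact mul_le_mul_of_nonneg_left (by linarith) (Nat.cast_nonneg N)
  -- Each starting point lies in one residue class modulo `H`, so adding the bounds for the `H`
  -- shifts counts every window once.
  have h2 : ∑ x ∈ Finset.range (N * H), H * v x ≤ H * (N * κ) := by
    rw [sum_range_mul, Finset.sum_comm]
    calc _ ≤ ∑ _m ∈ Finset.range H, (N * κ) :=
          Finset.sum_le_sum fun m _ => by simpa only [add_comm] using h1 m
      _ = _ := by simp
  rw [← Finset.mul_sum] at h2
  have h3 := le_of_mul_le_mul_left h2 hH'
  refine le_trans ?_ h3
  calc _ = ∑ x ∈ Finset.range (N + 1 - H), v x := by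
        refine Finset.sum_congr rfl fun x hx => ?_
        have := Finset.mem_range.1 hx
        simp only [hv]; rw [if_pos (by omega)]
    _ ≤ _ := by
        refine Finset.sum_le_sum_of_subset_of_nonneg (Finset.range_subset_range.2 ?_)
          fun x _ _ => hv0 x
        rcases Nat.eq_zero_or_pos N with rfl | hN
        · omega
        · have : N ≤ N * H := Nat.le_mul_of_pos_right N hH
          omega

/-- The sum of the local `U²` norms of a bounded function that does not correlate with locally
constant phases. -/
theorem sum_gowersU2Interval_le {H : ℕ+} (hF : ∀ n, ‖F n‖ ≤ 1) {κ ε : ℝ} (hε : 0 < ε)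
    (hκ : ∀ h, IsPhase N 1 (N / H + 1) h → msq N F ≤ msq N (fun n => F n - h n) + κ) :
    ∑ x ∈ Finset.range (N + 1 - H), gowersU2Interval F x H ≤ N * ε + 4 * N * κ / ε ^ 3 := by
  choose β hβ using fun x => exists_gowersU2Interval_pow_four_le hF x H
  have h1 := sum_localCorr_le hF H.pos hκ β
  -- Either the local norm `U` is at most `ε`, or `U ≤ U⁴ / ε³`, which the inverse theorem bounds.
  have hpt : ∀ x, gowersU2Interval F x H ≤ ε + 4 / ε ^ 3 * ‖localCorr F H (β x) x‖ ^ 2 := fun x => by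
    have h0 := gowersU2Interval_nonneg F x H
    set U := gowersU2Interval F x H
    rcases le_total U ε with h | h
    · have : 0 ≤ 4 / ε ^ 3 * ‖localCorr F H (β x) x‖ ^ 2 := by positivity
      linarith
    · have h2 : U ≤ U ^ 4 / ε ^ 3 := by
        rw [le_div_iff₀ (by positivity)]
        calc U * ε ^ 3 ≤ U * U ^ 3 := by gcongr
          _ = U ^ 4 := by ring
      have h3 : U ^ 4 / ε ^ 3 ≤ 4 * ‖localCorr F H (β x) x‖ ^ 2 / ε ^ 3 := by
        gcongr; exact hβ x
      have h4 : 4 * ‖localCorr F H (β x) x‖ ^ 2 / ε ^ 3 =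
          4 / ε ^ 3 * ‖localCorr F H (β x) x‖ ^ 2 := by ring
      linarith
  have hc : ((N + 1 - H : ℕ) : ℝ) ≤ N := by
    have := H.pos
    exact_mod_cast (by omega : N + 1 - (H : ℕ) ≤ N)
  calc _ ≤ ∑ x ∈ Finset.range (N + 1 - H), (ε + 4 / ε ^ 3 * ‖localCorr F H (β x) x‖ ^ 2) :=
        Finset.sum_le_sum fun x _ => hpt x
    _ = (N + 1 - H : ℕ) * ε + 4 / ε ^ 3 *
        ∑ x ∈ Finset.range (N + 1 - H), ‖localCorr F H (β x) x‖ ^ 2 := by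
        rw [Finset.sum_add_distrib, ← Finset.mul_sum]; simp
    _ ≤ N * ε + 4 / ε ^ 3 * (N * κ) := by gcongr
    _ = _ := by ring

/-- The mean of a bounded function that does not correlate with constants. -/
theorem sq_mean_le (hN : 0 < N) (hF : ∀ n, ‖F n‖ ≤ 1) {κ : ℝ}
    (hκ : ∀ h, IsPhase N 1 0 h → msq N F ≤ msq N (fun n => F n - h n) + κ) :
    ‖(1 / (N : ℂ)) * ∑ n ∈ Finset.Icc 1 N, F n‖ ^ 2 ≤ κ := by
  have hN' : (0 : ℝ) < N := by exact_mod_cast hN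
  have h3 : ∑ n ∈ Finset.Icc 1 N, F n = ∑ n ∈ Finset.range N, F (n + 1) := by
    rw [Finset.range_eq_Ico, Finset.sum_Ico_add' F 0 N 1]
    rfl
  have h4 : (1 / (N : ℂ)) * ∑ n ∈ Finset.Icc 1 N, F n = localCorr F N 0 0 := by
    rw [h3]; simp [localCorr, expTwoPiI_zero]
  have h5 := sum_sub_phase F hN 0 0
  simp only [mul_zero, expTwoPiI_zero, mul_one, zero_add] at h5
  rw [← msq_sub_msq N F fun n => F n - localCorr F N 0 0] at h5
  have h6 := mul_left_cancel₀ hN'.ne' h5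
  have h7 := hκ (fun _ => localCorr F N 0 0)
    (IsPhase.const_of_le (by simpa using norm_localCorr_le hF N 0 0) _ _)
  rw [h4, ← h6]
  linarith

end Blocks

/-! ### Choice of scales by pigeonhole. -/

/-- Along a decreasing sequence of numbers of breaks, the errors of approximation by few phases
are stable somewhere. -/
theorem exists_bestErr_stable {f : ℕ → ℝ} (hf : ∀ n, 0 ≤ f n ∧ f n ≤ 1) (D : ℕ) :
    ∃ J : ℕ, ∀ (N : ℕ) (B : ℕ → ℕ), Antitone B → ∃ j < J, ∀ d ≤ D,
      bestErr f N d (B (j + 1)) ≤ bestErr f N d (B j) + 1 / ((D : ℝ) + 1) := by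
  have hD : (0 : ℝ) < (D : ℝ) + 1 := by positivity
  -- The `D + 1` errors add up to at most `D + 1`, and every unstable step raises the total by more
  -- than `1 / (D + 1)`.
  refine ⟨(D + 1) ^ 2, fun N B hB => ?_⟩
  by_contra! hcon
  set S : ℕ → ℝ := fun j => ∑ d ∈ Finset.range (D + 1), bestErr f N d (B j)
  have hstep : ∀ j ∈ Finset.range ((D + 1) ^ 2), 1 / ((D : ℝ) + 1) < S (j + 1) - S j := by
    intro j hj
    obtain ⟨d, hd, hlt⟩ := hcon j (Finset.mem_range.1 hj)
    have h1 := Finset.single_le_sum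
      (f := fun d => bestErr f N d (B (j + 1)) - bestErr f N d (B j))
      (fun d _ => sub_nonneg.2 (bestErr_antitone le_rfl (hB (Nat.le_succ j))))
      (Finset.mem_range.2 (Nat.lt_succ_of_le hd))
    rw [Finset.sum_sub_distrib] at h1
    linarith
  have hsum := Finset.sum_lt_sum_of_nonempty (by simp) hstep
  rw [Finset.sum_range_sub] at hsum
  have h0 : 0 ≤ S 0 := Finset.sum_nonneg fun d _ => bestErr_nonneg _ _ _ _
  have h1 : S ((D + 1) ^ 2) ≤ D + 1 :=
    (Finset.sum_le_sum fun d _ => bestErr_le_one hf _ _ _).trans (by simp)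
  have h2 : ∑ _j ∈ Finset.range ((D + 1) ^ 2), 1 / ((D : ℝ) + 1) = D + 1 := by
    simp; field_simp
  linarith

open Classical in
/-- Among many consecutive ranges of values there is one that finitely many functions seldom
hit. -/
theorem exists_range_seldom_hit {ι : Type*} [Fintype ι] (θ : ι → ℕ → ℝ) {τ : ℕ → ℝ}
    (hτ : Antitone τ) (N : ℕ) {J : ℕ} (hJ : 0 < J) :
    ∃ i < J, ((Finset.Icc 1 N).filter fun n => ∃ w, τ (i + 1) ≤ θ w n ∧ θ w n < τ i).card * J ≤
      N * Fintype.card ι := by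
  by_contra! hcon
  set b : ℕ → ℕ := fun i =>
    ((Finset.Icc 1 N).filter fun n => ∃ w, τ (i + 1) ≤ θ w n ∧ θ w n < τ i).card
  have h1 : ∑ i ∈ Finset.range J, b i ≤ N * Fintype.card ι := by
    have h2 : ∀ i, b i ≤ ∑ w : ι, ∑ n ∈ Finset.Icc 1 N,
        if τ (i + 1) ≤ θ w n ∧ θ w n < τ i then 1 else 0 := fun i => by
      rw [Finset.sum_comm]
      simp only [b, Finset.card_filter]
      refine Finset.sum_le_sum fun n _ => ?_
      split_ifs with h
      · obtain ⟨w, hw⟩ := h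
        have := Finset.single_le_sum (f := fun w => if τ (i + 1) ≤ θ w n ∧ θ w n < τ i then 1 else 0)
          (fun _ _ => Nat.zero_le _) (Finset.mem_univ w)
        simpa [hw] using this
      · exact Nat.zero_le _
    calc _ ≤ ∑ i ∈ Finset.range J, ∑ w : ι, ∑ n ∈ Finset.Icc 1 N,
          (if τ (i + 1) ≤ θ w n ∧ θ w n < τ i then 1 else 0) := Finset.sum_le_sum fun i _ => h2 i
      _ = ∑ w : ι, ∑ n ∈ Finset.Icc 1 N, ∑ i ∈ Finset.range J,
          (if τ (i + 1) ≤ θ w n ∧ θ w n < τ i then 1 else 0) := by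
          rw [Finset.sum_comm]
          exact Finset.sum_congr rfl fun w _ => Finset.sum_comm
      _ ≤ ∑ w : ι, ∑ n ∈ Finset.Icc 1 N, 1 := by
          refine Finset.sum_le_sum fun w _ => Finset.sum_le_sum fun n _ => ?_
          -- The ranges are disjoint, so one value lies in at most one of them.
          rw [← Finset.card_filter, Finset.card_le_one]
          have key : ∀ i j, (τ (i + 1) ≤ θ w n ∧ θ w n < τ i) →
              (τ (j + 1) ≤ θ w n ∧ θ w n < τ j) → ¬ i < j := fun i j hi hj hij => by
            have := hτ (Nat.succ_le_of_lt hij)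
            have h1 := hi.1
            have h2 := hj.2
            simp only [Nat.succ_eq_add_one] at this
            linarith
          intro i hi j hj
          have h1 := (Finset.mem_filter.1 hi).2
          have h2 := (Finset.mem_filter.1 hj).2
          exact le_antisymm (not_lt.1 (key _ _ h2 h1)) (not_lt.1 (key _ _ h1 h2))
      _ = _ := by simp [mul_comm]
  have h3 : ∑ i ∈ Finset.range J, (N * Fintype.card ι) < ∑ i ∈ Finset.range J, b i * J :=
    Finset.sum_lt_sum_of_nonempty (by simpa using hJ.ne')
      fun i hi => hcon i (Finset.mem_range.1 hi)
  rw [← Finset.sum_mul] at h3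
  simp only [Finset.sum_const, Finset.card_range, smul_eq_mul] at h3
  have h4 := Nat.mul_le_mul_right J h1
  rw [mul_comm J, ← Finset.sum_mul] at h3
  rw [mul_right_comm] at h4
  exact absurd h3 (not_lt.2 h4)

/-- The distance to the nearest integer of an integer combination of the frequencies in `u`. -/
def freqDist {d : ℕ} (u : Fin d → ℂ × ℝ) (w : Fin d → ℤ) : ℝ :=
  ‖((∑ i, (w i : ℝ) * (u i).2 : ℝ) : UnitAddCircle)‖

open Classical in
/-- The points of `{1, …, N}` at which some integer combination of at most `D` frequencies, with
coefficients in `[-D, D]`, lies in `[1 / Hp, 1 / Hm)`. -/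
def badFreqSet (D N Hm Hp : ℕ) (u : ∀ d, ℕ → Fin d → ℂ × ℝ) : Finset ℕ :=
  (Finset.Icc 1 N).filter fun n => ∃ d ≤ D, ∃ w : Fin d → ℤ, (∀ i, |w i| ≤ D) ∧
    1 / (Hp : ℝ) ≤ freqDist (u d n) w ∧ freqDist (u d n) w < 1 / (Hm : ℝ)

/-- Near-optimal approximations of `f` by `d` phases on `{1, …, N}`, for all `d`, which are
constant on the scale `Hp`, cannot be improved on the scale `Hm`, and whose frequencies have
no dependencies between these scales. -/
structure Approximants (f : ℕ → ℝ) (D N Hm Hp : ℕ) where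
  Bm : ℕ
  Bp : ℕ
  u : ∀ d, ℕ → Fin d → ℂ × ℝ
  norm_le : ∀ d n i, ‖(u d n i).1‖ ≤ 1
  breaks : ∀ d, (breakSet (u d) N).card ≤ Bp
  err : ∀ d, msq N (fun n => (f n : ℂ) - phaseSum (u d) n) ≤ bestErr f N d Bp + 1 / ((D : ℝ) + 1)
  stable : ∀ d ≤ D, bestErr f N d Bp ≤ bestErr f N d Bm + 1 / ((D : ℝ) + 1)
  budget : D * Bp + N / Hm + 2 ≤ Bm
  Bp_mul_le : Bp * Hp ≤ N
  freq : (badFreqSet D N Hm Hp u).card * (D + 1) ≤ N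

/-- After multiplication by `Λ`, each of the three terms on the left is at most `N / 4`. -/
theorem budget_le {D N Λ T R H : ℕ} (hΛ : 0 < Λ) (hT : 4 * D + 4 ≤ T) (hR : T * T ≤ R)
    (hN : Λ * R ≤ N) (hH : Λ * T ≤ H) : D * (N / (Λ * R)) + N / H + 2 ≤ N / Λ := by
  rw [Nat.le_div_iff_mul_le hΛ]
  have h1 : N / (Λ * R) * (Λ * R) ≤ N := Nat.div_mul_le_self _ _
  have h2 : N / H * H ≤ N := Nat.div_mul_le_self _ _
  set a := N / (Λ * R)
  set b := N / H
  have hT1 : T ≤ R := (Nat.le_mul_of_pos_left T (by omega)).trans hR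
  have h6 : 4 * (b * Λ) ≤ N := by
    refine le_trans ?_ h2
    calc 4 * (b * Λ) = b * (Λ * 4) := by ring
      _ ≤ b * (Λ * T) := Nat.mul_le_mul_left _ (Nat.mul_le_mul_left _ (by omega))
      _ ≤ _ := Nat.mul_le_mul_left _ hH
  have h7 : 8 * Λ ≤ N := by
    refine le_trans ?_ hN
    rw [mul_comm]
    refine Nat.mul_le_mul_left _ (le_trans ?_ hR)
    exact (by norm_num : 8 ≤ 4 * 4).trans (Nat.mul_le_mul (by omega) (by omega))
  have h8 : 4 * (D * a * Λ) ≤ N := by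
    refine le_trans ?_ h1
    calc 4 * (D * a * Λ) = a * (Λ * (4 * D)) := by ring
      _ ≤ _ := Nat.mul_le_mul_left _ (Nat.mul_le_mul_left _ (by omega))
  have h9 : (D * a + b + 2) * Λ = D * a * Λ + b * Λ + 2 * Λ := by ring
  rw [h9]
  generalize D * a * Λ = x at *
  generalize b * Λ = y at *
  omega

theorem exists_approximants {f : ℕ → ℝ} (hf : ∀ n, 0 ≤ f n ∧ f n ≤ 1) (D : ℕ) :
    ∃ R : ℕ, ∀ N Km Kp : ℕ, 0 < Km → Km * R ≤ Kp → Kp ≤ N →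
      ∃ Hm Hp : ℕ, Km ≤ Hm ∧ (D + 1) * Hm ≤ Hp ∧ Hp ≤ Kp ∧ Nonempty (Approximants f D N Hm Hp) := by
  obtain ⟨J, hJ⟩ := exists_bestErr_stable hf D
  -- All pairs of a number of phases and a coefficient vector; with `J' = (D + 1) * W` candidate
  -- ranges, some range is hit at no more than `N / (D + 1)` points.
  set ι := Σ d : Fin (D + 1), (Fin d → Set.Icc (-(D : ℤ)) D) with hι
  set W := Fintype.card ι with hW
  have hWpos : 0 < W := Fintype.card_pos_iff.2 ⟨⟨0, fun i => i.elim0⟩⟩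
  set J' := (D + 1) * W with hJ'
  have hJ'pos : 0 < J' := by positivity
  obtain ⟨T, hT⟩ : ∃ T, T = 4 * D + 4 := ⟨_, rfl⟩
  have hTpos : 0 < T := by omega
  set R := T ^ (J' + 1) with hR
  have hRpos : 0 < R := by positivity
  have hTR : T * T ≤ R := by
    rw [hR, ← pow_two]; exact Nat.pow_le_pow_right hTpos (by omega)
  -- Each of the `J` candidate steps between allowances has ratio `R = T ^ (J' + 1)`, leaving room
  -- for `J'` subranges of ratio `T`, all at least `T` times coarser than `Λ`.
  refine ⟨R ^ J, fun N Km Kp hKm hKp hKN => ?_⟩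
  obtain ⟨j, hj, hstable⟩ := hJ N (fun j => N / (Km * R ^ j)) fun a b hab =>
    Nat.div_le_div_left (Nat.mul_le_mul_left _ (Nat.pow_le_pow_right hRpos hab)) (by positivity)
  set Λ := Km * R ^ j with hΛ
  have hΛpos : 0 < Λ := by positivity
  have hΛ' : Km * R ^ (j + 1) = Λ * R := by rw [hΛ, pow_succ, mul_assoc]
  have hΛN : Λ * R ≤ Kp := by
    rw [← hΛ']
    exact (Nat.mul_le_mul_left _ (Nat.pow_le_pow_right hRpos hj)).trans hKp
  have hKΛ : Km ≤ Λ := Nat.le_mul_of_pos_right _ (by positivity)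
  have hd1 : (0 : ℝ) < 1 / ((D : ℝ) + 1) := by positivity
  choose P hP hPerr using fun d => exists_lt_bestErr_add f N d (N / (Λ * R)) hd1
  choose u hu hPu hub using hP
  obtain ⟨i, hi, hbad⟩ := exists_range_seldom_hit
    (fun (w : ι) n => freqDist (u w.1 n) fun i => (w.2 i : ℤ))
    (τ := fun i => 1 / ((Λ * T ^ (i + 1) : ℕ) : ℝ))
    (fun a b hab => one_div_le_one_div_of_le (by positivity) (by
      exact_mod_cast Nat.mul_le_mul_left _ (Nat.pow_le_pow_right hTpos (by omega)))) N hJ'pos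
  have hHp : Λ * T ^ (i + 1 + 1) ≤ Λ * R :=
    Nat.mul_le_mul_left _ (Nat.pow_le_pow_right hTpos (by omega))
  have hHm : Λ * T ≤ Λ * T ^ (i + 1) := Nat.mul_le_mul_left _ (Nat.le_self_pow (by omega) _)
  refine ⟨Λ * T ^ (i + 1), Λ * T ^ (i + 1 + 1), ?_, ?_, hHp.trans hΛN,
    ⟨⟨N / Λ, N / (Λ * R), u, hu, hub, fun d => ?_, ?_, ?_, ?_, ?_⟩⟩⟩
  · exact hKΛ.trans (Nat.le_mul_of_pos_right _ (by positivity))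
  · rw [pow_succ T (i + 1), ← mul_assoc Λ, mul_comm (D + 1)]
    exact Nat.mul_le_mul_left _ (by omega)
  · have : P d = phaseSum (u d) := funext (hPu d)
    rw [← this]
    exact hPerr d
  · intro d hd
    have := hstable d hd
    rwa [hΛ'] at this
  · exact budget_le hΛpos hT.ge hTR (hΛN.trans hKN) hHm
  · exact (Nat.mul_le_mul_left _ hHp).trans (Nat.div_mul_le_self _ _)
  · refine Nat.le_of_mul_le_mul_right (c := W) ?_ hWpos
    rw [mul_assoc, ← hJ']
    refine le_trans (Nat.mul_le_mul_right _ (Finset.card_le_card fun n hn => ?_)) hbad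
    simp only [badFreqSet, Finset.mem_filter] at hn ⊢
    obtain ⟨hn, d, hd, w, hw, h1, h2⟩ := hn
    exact ⟨hn, ⟨⟨d, Nat.lt_succ_of_le hd⟩, fun i => ⟨w i, abs_le.1 (hw i)⟩⟩, h1, h2⟩

/-! ### Consequences of near-optimality. -/

namespace Approximants

variable {f : ℕ → ℝ} {D N Hm Hp r m C : ℕ} {η : ℝ}

/-- The truncated approximation of `f` by `r` phases. -/
def str (A : Approximants f D N Hm Hp) (r n : ℕ) : ℝ := clamp (phaseSum (A.u r) n).re

/-- The error of the best approximation by `d` phases. -/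
def optErr (A : Approximants f D N Hm Hp) (d : ℕ) : ℝ := bestErr f N d A.Bp

variable (A : Approximants f D N Hm Hp)

theorem isPhase (d : ℕ) : IsPhase N d A.Bp (phaseSum (A.u d)) :=
  ⟨A.u d, A.norm_le d, fun _ => rfl, A.breaks d⟩

theorem optErr_le_one (hf : ∀ n, 0 ≤ f n ∧ f n ≤ 1) (d : ℕ) : A.optErr d ≤ 1 :=
  bestErr_le_one hf _ _ _

theorem msq_sub_str_le (hf : ∀ n, 0 ≤ f n ∧ f n ≤ 1) :
    msq N (fun n => (f n : ℂ) - (A.str r n : ℂ)) ≤ A.optErr r + 1 / ((D : ℝ) + 1) := by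
  refine (msq_mono fun n => ?_).trans (A.err r)
  rw [← Complex.ofReal_sub, Complex.norm_real, Real.norm_eq_abs]
  refine (abs_sub_clamp_le (hf n).1 (hf n).2).trans ?_
  simpa using Complex.abs_re_le_norm ((f n : ℂ) - phaseSum (A.u r) n)

theorem optErr_le_of_isPhase {d B : ℕ} {P : ℕ → ℂ} (hP : IsPhase N d B P) (hd : d ≤ D)
    (hB : B ≤ A.Bm) :
    A.optErr d ≤ msq N (fun n => (f n : ℂ) - P n) + 1 / ((D : ℝ) + 1) :=
  (A.stable d hd).trans (by gcongr; exact bestErr_le (hP.mono_breaks hB))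

theorem one_div_le_one (D : ℕ) : 1 / ((D : ℝ) + 1) ≤ 1 := by
  rw [div_le_one (by positivity)]; linarith [(Nat.cast_nonneg D : (0 : ℝ) ≤ D)]

/-- The truncated approximation by `r` phases is close to the approximation by `d` phases. -/
theorem msq_phaseSum_sub_str_le (hf : ∀ n, 0 ≤ f n ∧ f n ≤ 1) (h0 : 0 < η) (h1 : η ≤ 1)
    (hG : ∀ (N B : ℕ) (P : ℕ → ℂ), IsPhase N r B P →
      ∃ G, IsPhase N m (C * B) G ∧ ∀ n, ‖(clamp (P n).re : ℂ) - G n‖ ≤ η)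
    {d : ℕ} (hd : d + m ≤ D) (hC : C + 1 ≤ D) :
    msq N (fun n => phaseSum (A.u d) n - (A.str r n : ℂ)) ≤
      2 * A.optErr d + 2 * A.optErr r - 4 * A.optErr (d + m) + 8 / ((D : ℝ) + 1) + 16 * η := by
  obtain ⟨G, hGp, hGn⟩ := hG N A.Bp _ (A.isPhase r)
  have e1 := A.err d
  have e2 := A.msq_sub_str_le (r := r) hf
  have b1 := A.optErr_le_one hf d
  have b2 := A.optErr_le_one hf r
  have hδ := one_div_le_one D
  have hpar := msq_parallelogram N (fun n => (f n : ℂ) - (A.str r n : ℂ))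
    (fun n => (f n : ℂ) - phaseSum (A.u d) n)
  have hpos := msq_nonneg N (fun n => (f n : ℂ) - (A.str r n : ℂ) -
    ((f n : ℂ) - phaseSum (A.u d) n))
  -- The midpoint of the two approximations is nearly a sum of `d + m` phases, so its error cannot
  -- fall much below `optErr (d + m)`.
  have hQ := (((A.isPhase d).add hGp).smul (z := 1 / 2) (by norm_num))
  have hB : A.Bp + C * A.Bp ≤ A.Bm := by
    refine le_trans ?_ A.budget
    calc A.Bp + C * A.Bp = (C + 1) * A.Bp := by ring
      _ ≤ D * A.Bp := Nat.mul_le_mul_right _ hC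
      _ ≤ _ := (Nat.le_add_right _ _).trans (Nat.le_add_right _ _)
  have h2 := A.optErr_le_of_isPhase hQ hd hB
  have hmid := msq_le_of_near (N := N) (η := η)
    (F := fun n => (f n : ℂ) - 1 / 2 * (phaseSum (A.u d) n + G n))
    (G := fun n => ((f n : ℂ) - (A.str r n : ℂ) + ((f n : ℂ) - phaseSum (A.u d) n)) / 2) h0 h1
    (fun n => by
      have : (f n : ℂ) - 1 / 2 * (phaseSum (A.u d) n + G n) -
          ((f n : ℂ) - (A.str r n : ℂ) + ((f n : ℂ) - phaseSum (A.u d) n)) / 2 =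
          (1 / 2) * ((A.str r n : ℂ) - G n) := by ring
      rw [this, norm_mul]
      have h3 : ‖(A.str r n : ℂ) - G n‖ ≤ η := hGn n
      have h4 : ‖(1 / 2 : ℂ)‖ = 1 / 2 := by norm_num
      rw [h4]; linarith) (by unfold optErr at *; linarith)
  have heq : msq N (fun n => (f n : ℂ) - (A.str r n : ℂ) - ((f n : ℂ) - phaseSum (A.u d) n)) =
      msq N (fun n => phaseSum (A.u d) n - (A.str r n : ℂ)) := by
    congr 1; ext n; ring
  rw [heq] at hpar
  have h8 : 8 / ((D : ℝ) + 1) = 8 * (1 / ((D : ℝ) + 1)) := by ring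
  rw [h8]
  unfold optErr at *
  linarith

/-- The error of the truncated approximation cannot be lowered much by one more phase. -/
theorem msq_sub_str_le_add (hf : ∀ n, 0 ≤ f n ∧ f n ≤ 1) (h0 : 0 < η) (h1 : η ≤ 1)
    (hG : ∀ (N B : ℕ) (P : ℕ → ℂ), IsPhase N r B P →
      ∃ G, IsPhase N m (C * B) G ∧ ∀ n, ‖(clamp (P n).re : ℂ) - G n‖ ≤ η)
    (hm : m + 1 ≤ D) (hC : C ≤ D) {h : ℕ → ℂ} (hh : IsPhase N 1 (N / Hm + 1) h) :
    msq N (fun n => (f n : ℂ) - (A.str r n : ℂ)) ≤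
      msq N (fun n => (f n : ℂ) - (A.str r n : ℂ) - h n) +
        (A.optErr r - A.optErr (m + 1) + 2 / ((D : ℝ) + 1) + 4 * η) := by
  obtain ⟨G, hGp, hGn⟩ := hG N A.Bp _ (A.isPhase r)
  have e2 := A.msq_sub_str_le (r := r) hf
  have b2 := A.optErr_le_one hf (m + 1)
  have hδ := one_div_le_one D
  have hδ0 : 0 < 1 / ((D : ℝ) + 1) := by positivity
  have h22 : 2 / ((D : ℝ) + 1) = 2 * (1 / ((D : ℝ) + 1)) := by ring
  rw [h22]
  -- If subtracting `h` leaves mean square at least `2`, the claim is trivial, since optimal errors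
  -- are at most `1`.
  rcases le_total (msq N (fun n => (f n : ℂ) - (A.str r n : ℂ) - h n)) 2 with hle | hle
  · have hB : C * A.Bp + (N / Hm + 1) ≤ A.Bm := by
      refine le_trans ?_ A.budget
      have := Nat.mul_le_mul_right A.Bp hC
      omega
    have h2 := A.optErr_le_of_isPhase (hGp.add hh) hm hB
    have hmid := msq_le_of_near (N := N) (η := η)
      (F := fun n => (f n : ℂ) - (G n + h n))
      (G := fun n => (f n : ℂ) - (A.str r n : ℂ) - h n) h0 h1
      (fun n => by
        have : (f n : ℂ) - (G n + h n) - ((f n : ℂ) - (A.str r n : ℂ) - h n) =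
            (A.str r n : ℂ) - G n := by ring
        rw [this]
        exact hGn n) hle
    linarith
  · linarith

end Approximants

/-! ### Passage to subsequences. -/

theorem badFreqSet_mono {D D' N Hm Hp : ℕ} (h : D ≤ D') (u : ∀ d, ℕ → Fin d → ℂ × ℝ) :
    badFreqSet D N Hm Hp u ⊆ badFreqSet D' N Hm Hp u := by
  intro n hn
  simp only [badFreqSet, Finset.mem_filter] at hn ⊢
  obtain ⟨hn, d, hd, w, hw, h1⟩ := hn
  exact ⟨hn, d, hd.trans h, w, fun i => (hw i).trans (by exact_mod_cast h), h1⟩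

/-- A structured function `g` with values in `[0, 1]` such that `f - g` is uniform on the
scale `Hm`, and phase sums `phaseSum (u d)` which are constant on the scale `Hp` and whose
frequencies have no dependencies between the two scales. -/
structure StrUnf (f : ℕ → ℝ) (κ : ℝ) (D N Hm Hp : ℕ) where
  u : ∀ d, ℕ → Fin d → ℂ × ℝ
  g : ℕ → ℝ
  norm_le : ∀ d n i, ‖(u d n i).1‖ ≤ 1
  breaks : ∀ d, (breakSet (u d) N).card * Hp ≤ N
  freq : (badFreqSet D N Hm Hp u).card * (D + 1) ≤ N
  g_mem : ∀ n, 0 ≤ g n ∧ g n ≤ 1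
  uniform : ∀ h, IsPhase N 1 (N / Hm + 1) h →
    msq N (fun n => (f n : ℂ) - (g n : ℂ)) ≤ msq N (fun n => (f n : ℂ) - (g n : ℂ) - h n) + κ

/-- A smaller bound for the coefficients. -/
def StrUnf.mono {f : ℕ → ℝ} {κ : ℝ} {D D' N Hm Hp : ℕ} (S : StrUnf f κ D' N Hm Hp) (h : D ≤ D') :
    StrUnf f κ D N Hm Hp :=
  { S with
    freq := (Nat.mul_le_mul (Finset.card_le_card (badFreqSet_mono h _)) (by omega)).trans S.freq }

/-- The mean square distance between the structured function and the sum of `d` phases. -/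
def StrUnf.dist {f : ℕ → ℝ} {κ : ℝ} {D N Hm Hp : ℕ} (S : StrUnf f κ D N Hm Hp) (d : ℕ) : ℝ :=
  msq N (fun n => phaseSum (S.u d) n - (S.g n : ℂ))

theorem tendsto_one_div_succ : Tendsto (fun r : ℕ => 1 / ((r : ℝ) + 1)) atTop (𝓝 0) :=
  tendsto_one_div_add_atTop_nhds_zero_nat

theorem exists_subseq_tendsto_pi {E : ℕ → ℕ → ℝ} {b : ℕ → ℝ}
    (hE : ∀ k d, E k d ∈ Set.Icc 0 (b d)) :
    ∃ (q : ℕ → ℝ) (φ : ℕ → ℕ), StrictMono φ ∧ ∀ d, Tendsto (fun k => E (φ k) d) atTop (𝓝 (q d)) := by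
  obtain ⟨q, -, φ, hφ, hq⟩ := (isCompact_univ_pi fun d => isCompact_Icc (a := (0 : ℝ)) (b := b d)
    ).tendsto_subseq (x := E) fun k d _ => hE k d
  exact ⟨q, φ, hφ, fun d => (tendsto_pi_nhds.1 hq) d⟩

/-- Stage `r` truncates a near-minimiser with `r` terms, taken from approximants whose parameter `D`
is large in terms of `r`. All errors are compared with the limits `q d` of the optimal errors, and
`q` decreases to its infimum `qi`. -/
theorem exists_strUnf {f : ℕ → ℝ} (hf : ∀ n, 0 ≤ f n ∧ f n ≤ 1) {N Kp Km : ℕ → ℕ}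
    (hKm : ∀ s, 0 < Km s) (hK : ∀ R : ℕ, ∀ᶠ s in atTop, Km s * R ≤ Kp s)
    (hKN : ∀ᶠ s in atTop, Kp s ≤ N s) :
    ∃ t : ℕ → ℕ, StrictMono t ∧ ∃ (Hm Hp : ℕ → ℕ) (κ b e : ℕ → ℝ)
      (S : ∀ s, StrUnf f (κ s) s (N (t s)) (Hm s) (Hp s)),
      (∀ s, Km (t s) ≤ Hm s ∧ (s + 1) * Hm s ≤ Hp s ∧ Hp s ≤ Kp (t s) ∧ Kp (t s) ≤ N (t s)) ∧
      Tendsto κ atTop (𝓝 0) ∧ Tendsto b atTop (𝓝 0) ∧ Tendsto e atTop (𝓝 0) ∧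
      ∀ d s, d ≤ s → (S s).dist d ≤ b d + e s := by
  choose R hR using exists_approximants hf
  -- The gap required between the scales depends on `D` and is available only for late indices, so
  -- `D` is paired with `t₀ D`.
  obtain ⟨t₀, ht₀, hs⟩ := extraction_forall_of_eventually fun D => (hK (R D)).and hKN
  choose Hm Hp h1 h2 h3 A using fun D =>
    hR D (N (t₀ D)) (Km (t₀ D)) (Kp (t₀ D)) (hKm _) (hs D).1 (hs D).2
  replace A := fun D => (A D).some
  obtain ⟨q, φ, hφ, hq⟩ := exists_subseq_tendsto_pi (E := fun k d => (A k).optErr d)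
    (b := fun _ => 1) fun k d => ⟨bestErr_nonneg _ _ _ _, (A k).optErr_le_one hf d⟩
  have hq_anti : Antitone q := fun d d' h =>
    le_of_tendsto_of_tendsto' (hq d') (hq d) fun k => bestErr_antitone h le_rfl
  have hq0 : ∀ d, 0 ≤ q d := fun d => ge_of_tendsto' (hq d) fun k => bestErr_nonneg _ _ _ _
  have hqbdd : BddBelow (Set.range q) := ⟨0, by rintro _ ⟨d, rfl⟩; exact hq0 d⟩
  have hqlim := tendsto_atTop_ciInf hq_anti hqbdd
  set qi := ⨅ d, q d
  have hqi : ∀ d, qi ≤ q d := fun d => ciInf_le hqbdd d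
  have hη : ∀ r : ℕ, (0 : ℝ) < 1 / ((r : ℝ) + 1) := fun r => by positivity
  choose m C hG using fun r : ℕ => exists_isPhase_near_clamp r (hη r)
  -- Only finitely many errors matter for a given `r`, so late in the sequence all of them are close
  -- to their limits and `D = φ k` exceeds the complexity of the truncation.
  have hev : ∀ r : ℕ, ∀ᶠ k in atTop, (r + m r + C r + 1 ≤ φ k) ∧
      ∀ d ∈ Finset.range (r + m r + 2), |(A (φ k)).optErr d - q d| < 1 / ((r : ℝ) + 1) := by
    intro r
    refine (hφ.tendsto_atTop.eventually_ge_atTop _).and ?_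
    rw [Finset.eventually_all]
    intro d _
    have := Metric.tendsto_nhds.1 (hq d) _ (hη r)
    simpa only [Real.dist_eq] using this
  obtain ⟨ψ, hψ, hψr⟩ := extraction_forall_of_eventually hev
  have hη1 : ∀ r : ℕ, 1 / ((r : ℝ) + 1) ≤ 1 := Approximants.one_div_le_one
  have hDr : ∀ r, r ≤ φ (ψ r) := fun r => (hψ.id_le r).trans (hφ.id_le _)
  have hD : ∀ r, 1 / (((φ (ψ r) : ℕ) : ℝ) + 1) ≤ 1 / ((r : ℝ) + 1) := fun r => by
    have : (r : ℝ) ≤ (φ (ψ r) : ℕ) := by exact_mod_cast hDr r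
    gcongr
  have hclose : ∀ r d, d ≤ r + m r + 1 → (A (φ (ψ r))).optErr d ≤ q d + 1 / ((r : ℝ) + 1) ∧
      q d ≤ (A (φ (ψ r))).optErr d + 1 / ((r : ℝ) + 1) := fun r d hd => by
    have := abs_lt.1 ((hψr r).2 d (Finset.mem_range.2 (by omega)))
    constructor <;> linarith [this.1, this.2]
  have hκ : Tendsto (fun r : ℕ => q r - qi + 8 * (1 / ((r : ℝ) + 1))) atTop (𝓝 0) := by
    have := (hqlim.sub_const qi).add (tendsto_one_div_succ.const_mul 8)
    simpa using this
  refine ⟨fun r => t₀ (φ (ψ r)), fun a b hab => ht₀ (hφ (hψ hab)), fun r => Hm (φ (ψ r)),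
    fun r => Hp (φ (ψ r)), fun r => q r - qi + 8 * (1 / ((r : ℝ) + 1)),
    fun d => 2 * (q d - qi), fun r => 2 * (q r - qi) + 32 * (1 / ((r : ℝ) + 1)),
    fun r => StrUnf.mono ⟨(A (φ (ψ r))).u, (A (φ (ψ r))).str r, (A (φ (ψ r))).norm_le,
      fun d => (Nat.mul_le_mul_right _ ((A (φ (ψ r))).breaks d)).trans (A (φ (ψ r))).Bp_mul_le,
      (A (φ (ψ r))).freq, fun n => ⟨clamp_nonneg _, clamp_le_one _⟩, fun h hh => ?_⟩ (hDr r),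
    fun r => ⟨h1 _, (Nat.mul_le_mul_right _ (Nat.succ_le_succ (hDr r))).trans (h2 _), h3 _, (hs _).2⟩, hκ, ?_, ?_, ?_⟩
  · have hcond := (hψr r).1
    refine ((A (φ (ψ r))).msq_sub_str_le_add hf (hη r) (hη1 r) (hG r) (by omega) (by omega)
      hh).trans ?_
    have c1 := (hclose r r (by omega)).1
    have c2 := (hclose r (m r + 1) (by omega)).2
    have c3 := hqi (m r + 1)
    have c4 := hD r
    have c5 : 2 / (((φ (ψ r) : ℕ) : ℝ) + 1) = 2 * (1 / (((φ (ψ r) : ℕ) : ℝ) + 1)) := by ring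
    rw [c5]
    linarith
  · have := (hqlim.sub_const qi).const_mul 2
    simpa using this
  · have := ((hqlim.sub_const qi).const_mul 2).add (tendsto_one_div_succ.const_mul 32)
    simpa using this
  · intro d r hdr
    have hcond := (hψr r).1
    refine ((A (φ (ψ r))).msq_phaseSum_sub_str_le hf (hη r) (hη1 r) (hG r) (by omega)
      (by omega)).trans ?_
    have c0 := (hclose r d (by omega)).1
    have c1 := (hclose r r (by omega)).1
    have c2 := (hclose r (d + m r) (by omega)).2
    have c3 := hqi (d + m r)
    have c4 := hD r
    have c5 : 8 / (((φ (ψ r) : ℕ) : ℝ) + 1) = 8 * (1 / (((φ (ψ r) : ℕ) : ℝ) + 1)) := by ring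
    rw [c5]
    linarith

theorem StrUnf.dist_mem_Icc {f : ℕ → ℝ} {κ : ℝ} {D N Hm Hp : ℕ} (S : StrUnf f κ D N Hm Hp)
    (d : ℕ) : S.dist d ∈ Set.Icc (0 : ℝ) (((d : ℝ) + 1) ^ 2) := by
  refine ⟨msq_nonneg _ _, msq_le_of_norm_le fun n => (norm_sub_le _ _).trans ?_⟩
  have h1 : ‖phaseSum (S.u d) n‖ ≤ d :=
    IsPhase.norm_le (N := N) ⟨S.u d, S.norm_le d, fun _ => rfl, le_rfl⟩ n
  have h2 : ‖(S.g n : ℂ)‖ ≤ 1 := by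
    rw [Complex.norm_real, Real.norm_eq_abs, abs_of_nonneg (S.g_mem n).1]
    exact (S.g_mem n).2
  linarith

theorem exists_subseq_growing {N : ℕ → ℕ} (hN : Tendsto N atTop atTop) :
    ∃ φ : ℕ → ℕ, StrictMono φ ∧ ∀ s, (s + 1) * N (φ s) ≤ N (φ (s + 1)) := by
  choose g hg1 hg2 using fun n : ℕ =>
    ((eventually_gt_atTop n).and (hN.eventually_ge_atTop ((n + 1) * N n))).exists
  have hmono : StrictMono fun k => g^[k] 0 := strictMono_nat_of_lt_succ fun k => by
    simp only [Function.iterate_succ_apply']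
    exact hg1 _
  refine ⟨fun k => g^[k] 0, hmono, fun s => ?_⟩
  simp only [Function.iterate_succ_apply']
  exact (Nat.mul_le_mul_right _ (Nat.succ_le_succ (hmono.id_le s))).trans (hg2 _)

theorem exists_strUnf_growing {f : ℕ → ℝ} (hf : ∀ n, 0 ≤ f n ∧ f n ≤ 1) {N Kp Km : ℕ → ℕ}
    (hKm : ∀ s, 0 < Km s) (hK : ∀ R : ℕ, ∀ᶠ s in atTop, Km s * R ≤ Kp s)
    (hKN : ∀ᶠ s in atTop, Kp s ≤ N s) :
    ∃ t : ℕ → ℕ, StrictMono t ∧ ∃ (Hm Hp : ℕ → ℕ) (κ q : ℕ → ℝ)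
      (S : ∀ s, StrUnf f (κ s) s (N (t s)) (Hm s) (Hp s)),
      (∀ s, Km (t s) ≤ Hm s ∧ (s + 1) * Hm s ≤ Hp s ∧ Hp s ≤ Kp (t s) ∧ Kp (t s) ≤ N (t s)) ∧
      (∀ s, (s + 1) * N (t s) ≤ N (t (s + 1))) ∧
      Tendsto κ atTop (𝓝 0) ∧ (∀ d, Tendsto (fun s => (S s).dist d) atTop (𝓝 (q d))) ∧
      ∀ ε > 0, ∀ᶠ d in atTop, q d ≤ ε := by
  obtain ⟨t, ht, Hm, Hp, κ, b, e, S, hsc, hκ, hb, he, hS⟩ := exists_strUnf hf hKm hK hKN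
  obtain ⟨q, φ, hφ, hq⟩ := exists_subseq_tendsto_pi (E := fun s d => (S s).dist d)
    fun s d => (S s).dist_mem_Icc d
  have hNtop : Tendsto (fun s => N (t (φ s))) atTop atTop := by
    -- `N` is unbounded because it dominates `(s + 1) * Hm`, where `Hm` is positive.
    refine tendsto_atTop_mono (fun s => ?_) tendsto_id
    obtain ⟨h1, h2, h3, h4⟩ := hsc (φ s)
    have h5 : φ s ≤ (φ s + 1) * Hm (φ s) :=
      (Nat.le_succ _).trans (Nat.le_mul_of_pos_right _ ((hKm _).trans_le h1))
    exact (hφ.id_le s).trans (h5.trans (h2.trans (h3.trans h4)))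
  obtain ⟨χ, hχ, hgrow⟩ := exists_subseq_growing hNtop
  have hle : ∀ s, s ≤ φ (χ s) := fun s => (hχ.id_le s).trans (hφ.id_le _)
  have hφχ : Tendsto (fun s => φ (χ s)) atTop atTop := (hφ.comp hχ).tendsto_atTop
  refine ⟨fun s => t (φ (χ s)), fun a b hab => ht (hφ (hχ hab)), fun s => Hm (φ (χ s)),
    fun s => Hp (φ (χ s)), fun s => κ (φ (χ s)), q, fun s => (S (φ (χ s))).mono (hle s),
    fun s => ?_, hgrow, hκ.comp hφχ, fun d => (hq d).comp hχ.tendsto_atTop, fun ε hε => ?_⟩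
  · obtain ⟨h1, h2, h3, h4⟩ := hsc (φ (χ s))
    exact ⟨h1, (Nat.mul_le_mul_right _ (Nat.succ_le_succ (hle s))).trans h2, h3, h4⟩
  · filter_upwards [hb.eventually (ge_mem_nhds hε)] with d hd
    have hlim : Tendsto (fun s => b d + e (φ s)) atTop (𝓝 (b d + 0)) :=
      tendsto_const_nhds.add (he.comp hφ.tendsto_atTop)
    rw [add_zero] at hlim
    refine (le_of_tendsto_of_tendsto (hq d) hlim ?_).trans hd
    filter_upwards [eventually_ge_atTop d] with s hs
    exact hS d (φ s) (hs.trans (hφ.id_le s))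


/-! ### Averages insensitive to negligible sets. -/

theorem tendsto_mean_congr {W T : ℕ → ℕ} {φ ψ : ℕ → ℕ → ℝ} {b L : ℝ}
    (h : ∀ s n, |φ s n - ψ s n| ≤ b) (h0 : ∀ s n, T s < n → n ≤ W s → φ s n = ψ s n)
    (hT : Tendsto (fun s => (T s : ℝ) / (W s : ℝ)) atTop (𝓝 0))
    (hψ : Tendsto (fun s => (1 / (W s : ℝ)) * ∑ n ∈ Finset.Icc 1 (W s), ψ s n) atTop (𝓝 L)) :
    Tendsto (fun s => (1 / (W s : ℝ)) * ∑ n ∈ Finset.Icc 1 (W s), φ s n) atTop (𝓝 L) := by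
  have hb : 0 ≤ b := (abs_nonneg _).trans (h 0 0)
  have hdiff : Tendsto (fun s => (1 / (W s : ℝ)) * ∑ n ∈ Finset.Icc 1 (W s), φ s n -
      (1 / (W s : ℝ)) * ∑ n ∈ Finset.Icc 1 (W s), ψ s n) atTop (𝓝 0) := by
    have hlim := hT.const_mul b
    rw [mul_zero] at hlim
    refine squeeze_zero_norm (fun s => ?_) hlim
    rw [← mul_sub, ← Finset.sum_sub_distrib, norm_mul]
    have h1 : ‖∑ n ∈ Finset.Icc 1 (W s), (φ s n - ψ s n)‖ ≤ b * T s := by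
      refine (norm_sum_le _ _).trans ?_
      calc _ ≤ ∑ n ∈ Finset.Icc 1 (W s), (if n ∈ Finset.Icc 1 (T s) then b else 0) := by
            refine Finset.sum_le_sum fun n hn => ?_
            have hn' := Finset.mem_Icc.1 hn
            split_ifs with hnT
            · exact h s n
            · rw [h0 s n (by rw [Finset.mem_Icc] at hnT; omega) hn'.2]; simp
        _ = ((Finset.Icc 1 (W s) ∩ Finset.Icc 1 (T s)).card : ℝ) * b := by
            rw [Finset.sum_ite_mem]; simp
        _ ≤ ((Finset.Icc 1 (T s)).card : ℝ) * b := by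
            gcongr; exact Finset.inter_subset_right
        _ = _ := by simp [mul_comm]
    calc _ ≤ ‖(1 / (W s : ℝ))‖ * (b * T s) := by gcongr
      _ = _ := by rw [Real.norm_of_nonneg (by positivity)]; ring
  simpa using hdiff.add hψ

namespace Scale

theorem Prec.eventually_mul_le {H K : Scale} (h : H.Prec K) {C : ℝ} (hC : 0 < C) :
    ∀ᶠ s in atTop, C * ((H s : ℕ) : ℝ) ≤ ((K s : ℕ) : ℝ) := by
  filter_upwards [h.eventually (ge_mem_nhds (show (0 : ℝ) < 1 / C by positivity))] with s hs
  have : (0 : ℝ) < (K s : ℕ) := by exact_mod_cast (K s).pos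
  rw [div_le_div_iff₀ this hC] at hs
  linarith

theorem Prec.eventually_le_numWindows {H N : Scale} (h : H.Prec N) :
    ∀ᶠ s in atTop, (N s : ℕ) ≤ 2 * numWindows N H s := by
  filter_upwards [h.eventually_mul_le two_pos] with s hs
  have hs' : 2 * (H s : ℕ) ≤ (N s : ℕ) := by exact_mod_cast hs
  unfold numWindows
  omega

theorem Prec.trans_le {H K N : Scale} (h : H.Prec K) (hK : ∀ s, K s ≤ N s) : H.Prec N := by
  refine squeeze_zero (fun s => by positivity) (fun s => ?_) h
  have h1 : (0 : ℝ) < (K s : ℕ) := by exact_mod_cast (K s).pos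
  have h2 : ((K s : ℕ) : ℝ) ≤ (N s : ℕ) := by exact_mod_cast hK s
  gcongr

end Scale

theorem tendsto_div_numWindows {N H : Scale} (h : H.Prec N) {b : ℕ → ℕ}
    (hb : Tendsto (fun s => (b s : ℝ) / ((N s : ℕ) : ℝ)) atTop (𝓝 0)) :
    Tendsto (fun s => (b s : ℝ) / (numWindows N H s : ℝ)) atTop (𝓝 0) := by
  have hlim := hb.const_mul 2
  rw [mul_zero] at hlim
  refine squeeze_zero' (Eventually.of_forall fun s => by positivity) ?_ hlim
  filter_upwards [h.eventually_le_numWindows] with s hs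
  have hN : (0 : ℝ) < (N s : ℕ) := by exact_mod_cast (N s).pos
  have hs' : ((N s : ℕ) : ℝ) ≤ 2 * (numWindows N H s : ℝ) := by exact_mod_cast hs
  have hW : (0 : ℝ) < numWindows N H s := by linarith
  rw [← mul_div_assoc, div_le_div_iff₀ hW hN]
  nlinarith [(Nat.cast_nonneg (b s) : (0 : ℝ) ≤ b s)]

/-- `T` stands for the initial segment lost to gluing, `E` for the exceptional points of the current
stage. -/
theorem asymptoticallyFull_of_forall_not_mem {N H : Scale} (h : H.Prec N) {S : ℕ → Set ℕ}
    {T : ℕ → ℕ} {E : ℕ → Finset ℕ}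
    (hS : ∀ᶠ s in atTop, ∀ n, 1 ≤ n → n ≤ numWindows N H s → T s < n → n ∉ E s → n ∈ S s)
    (hT : Tendsto (fun s => (T s : ℝ) / ((N s : ℕ) : ℝ)) atTop (𝓝 0))
    (hE : Tendsto (fun s => ((E s).card : ℝ) / ((N s : ℕ) : ℝ)) atTop (𝓝 0)) :
    AsymptoticallyFull N H S := by
  have hT' := tendsto_div_numWindows h hT
  have hE' := tendsto_div_numWindows h hE
  have hlim : Tendsto (fun s => 1 - ((T s : ℝ) / (numWindows N H s : ℝ) +
      ((E s).card : ℝ) / (numWindows N H s : ℝ))) atTop (𝓝 1) := by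
    simpa using (hT'.add hE').const_sub 1
  have hfin : ∀ s, (S s ∩ Set.Icc 1 (numWindows N H s)).Finite := fun s =>
    (Set.finite_Icc _ _).subset Set.inter_subset_right
  refine tendsto_of_tendsto_of_tendsto_of_le_of_le' hlim tendsto_const_nhds ?_ ?_
  · filter_upwards [h.eventually_le_numWindows, hS] with s hs hSs
    have hW : (0 : ℝ) < numWindows N H s := by
      have := (N s).pos
      exact_mod_cast (by omega : 0 < numWindows N H s)
    rw [le_div_iff₀ hW, sub_mul, add_mul, div_mul_cancel₀ _ hW.ne', div_mul_cancel₀ _ hW.ne',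
      one_mul]
    have hsub : Set.Icc 1 (numWindows N H s) ⊆ (S s ∩ Set.Icc 1 (numWindows N H s)) ∪
        ((Finset.Icc 1 (T s) ∪ E s : Finset ℕ) : Set ℕ) := by
      intro n hn
      by_contra hc
      simp only [Finset.coe_union, Finset.coe_Icc, Set.mem_union, Set.mem_inter_iff, hn, and_true,
        Set.mem_Icc, hn.1, true_and, Finset.mem_coe, not_or, not_le] at hc
      exact hc.1 (hSs n hn.1 hn.2 hc.2.1 hc.2.2)
    have h1 := Set.ncard_le_ncard hsub ((hfin s).union (Finset.finite_toSet _))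
    have h2 := Set.ncard_union_le (S s ∩ Set.Icc 1 (numWindows N H s))
      ((Finset.Icc 1 (T s) ∪ E s : Finset ℕ) : Set ℕ)
    rw [Set.ncard_coe_finset] at h2
    have h3 := Finset.card_union_le (Finset.Icc 1 (T s)) (E s)
    have h4 : (Set.Icc 1 (numWindows N H s)).ncard = numWindows N H s := by
      rw [← Finset.coe_Icc, Set.ncard_coe_finset]; simp
    rw [Nat.card_Icc, Nat.add_sub_cancel] at h3
    have h5 : numWindows N H s ≤
        (S s ∩ Set.Icc 1 (numWindows N H s)).ncard + (T s + (E s).card) := by omega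
    have h6 : (numWindows N H s : ℝ) ≤
        ((S s ∩ Set.Icc 1 (numWindows N H s)).ncard : ℝ) + ((T s : ℝ) + ((E s).card : ℝ)) := by
      exact_mod_cast h5
    linarith
  · refine Eventually.of_forall fun s => div_le_one_of_le₀ ?_ (by positivity)
    have h1 := Set.ncard_le_ncard
      (Set.inter_subset_right : S s ∩ Set.Icc 1 (numWindows N H s) ⊆ _) (Set.finite_Icc _ _)
    have h4 : (Set.Icc 1 (numWindows N H s)).ncard = numWindows N H s := by
      rw [← Finset.coe_Icc, Set.ncard_coe_finset]; simp
    exact_mod_cast h1.trans h4.le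

/-! ### Gluing the stages into one decomposition. -/

/-- The least `s` with `n ≤ N s`. -/
def stageOf (N : ℕ → ℕ) (n : ℕ) : ℕ := sInf {s | n ≤ N s}

/-- For `s = 0` the hypotheses contradict each other because `0 - 1 = 0`; a single stage does not
affect limits. -/
theorem stageOf_eq {N : ℕ → ℕ} (hN : Monotone N) {s n : ℕ} (h1 : N (s - 1) < n) (h2 : n ≤ N s) :
    stageOf N n = s := by
  refine le_antisymm (Nat.sInf_le h2) (le_csInf ⟨s, h2⟩ fun s' hs' => ?_)
  by_contra! hlt
  have := hN (show s' ≤ s - 1 by omega)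
  have hs'' : n ≤ N s' := hs'
  omega

/-- A break at `k` separates `k` from `k + 1`, so only those with `n < k < n + H` affect `{n + 1, …,
n + H}`. -/
theorem eq_of_no_break {E : Type*} {u : ℕ → E} {N n H : ℕ} (hnN : n + H ≤ N)
    (h : ∀ k ∈ breakSet u N, ¬ (n < k ∧ k < n + H)) {m : ℕ} (h1 : 1 ≤ m) (hm : m ≤ H) :
    u (n + m) = u (n + 1) := by
  induction m, h1 using Nat.le_induction with
  | base => rfl
  | succ m h1 ih =>
    rw [← ih (by omega), ← add_assoc]
    by_contra hne
    exact h (n + m) (by simp only [breakSet, Finset.mem_filter, Finset.mem_range]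
                        exact ⟨by omega, hne⟩) ⟨by omega, by omega⟩

section Glue

variable {f : ℕ → ℝ} {N Hm Hp : Scale} {κ q : ℕ → ℝ}
  (S : ∀ s, StrUnf f (κ s) s (N s) (Hm s) (Hp s))

/-- The structured function which is given by the one for the stage `s` on
`{N_{s-1} + 1, …, N_s}`. -/
def gluedStr (n : ℕ) : ℝ := (S (stageOf (fun s => N s) n)).g n

/-- The data of phase sums glued in the same way. -/
def gluedData (d n : ℕ) : Fin d → ℂ × ℝ := (S (stageOf (fun s => N s) n)).u d n

variable {S}

theorem gluedStr_eq (hN : Monotone fun s => (N s : ℕ)) {s n : ℕ} (h1 : (N (s - 1) : ℕ) < n)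
    (h2 : n ≤ N s) : gluedStr S n = (S s).g n := by
  rw [gluedStr, stageOf_eq hN h1 h2]

theorem gluedData_eq (hN : Monotone fun s => (N s : ℕ)) {s n : ℕ} (h1 : (N (s - 1) : ℕ) < n)
    (h2 : n ≤ N s) (d : ℕ) : gluedData S d n = (S s).u d n := by
  rw [gluedData, stageOf_eq hN h1 h2]

theorem gluedStr_mem (n : ℕ) : 0 ≤ gluedStr S n ∧ gluedStr S n ≤ 1 := (S _).g_mem n

theorem abs_sub_le_one_of_mem {a b : ℝ} (ha : 0 ≤ a ∧ a ≤ 1) (hb : 0 ≤ b ∧ b ≤ 1) :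
    |a - b| ≤ 1 := abs_le.2 ⟨by linarith [ha.1, hb.2], by linarith [ha.2, hb.1]⟩

theorem norm_sub_le_one_of_mem {a b : ℝ} (ha : 0 ≤ a ∧ a ≤ 1) (hb : 0 ≤ b ∧ b ≤ 1) :
    ‖((a - b : ℝ) : ℂ)‖ ≤ 1 := by
  rw [Complex.norm_real]; exact abs_sub_le_one_of_mem ha hb

theorem hasMeanAlong_sub_gluedStr (hf : ∀ n, 0 ≤ f n ∧ f n ≤ 1)
    (hN : Monotone fun s => (N s : ℕ))
    (hgrow : Tendsto (fun s => ((N (s - 1) : ℕ) : ℝ) / ((N s : ℕ) : ℝ)) atTop (𝓝 0))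
    (hκ : Tendsto κ atTop (𝓝 0)) : HasMeanAlong N (fun n => f n - gluedStr S n) 0 := by
  refine tendsto_mean_congr (W := fun s => N s) (T := fun s => N (s - 1))
    (φ := fun _ n => f n - gluedStr S n) (ψ := fun s n => f n - (S s).g n) (b := 1)
    (fun s n => ?_) (fun s n h1 h2 => by rw [gluedStr_eq hN h1 h2]) hgrow ?_
  · rw [sub_sub_sub_cancel_left]
    exact abs_sub_le_one_of_mem ((S s).g_mem n) (gluedStr_mem n)
  · have hsqrt : Tendsto (fun s => √(κ s)) atTop (𝓝 0) := by
      simpa using hκ.sqrt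
    refine squeeze_zero_norm (fun s => ?_) hsqrt
    rw [Real.norm_eq_abs]
    refine Real.abs_le_sqrt ?_
    have h := sq_mean_le (F := fun n => ((f n - (S s).g n : ℝ) : ℂ)) (κ := κ s) (N s).pos
      (fun n => norm_sub_le_one_of_mem (hf n) ((S s).g_mem n))
      (fun h hh => by
        have := (S s).uniform h (hh.mono_breaks (Nat.zero_le _))
        simpa only [Complex.ofReal_sub] using this)
    rw [← Complex.ofReal_sum, ← Complex.ofReal_natCast, ← Complex.ofReal_one,
      ← Complex.ofReal_div, ← Complex.ofReal_mul, Complex.norm_real, Real.norm_eq_abs, sq_abs] at h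
    exact h

theorem hasU2Seminorm_sub_gluedStr (hf : ∀ n, 0 ≤ f n ∧ f n ≤ 1)
    (hN : Monotone fun s => (N s : ℕ))
    (hgrow : Tendsto (fun s => ((N (s - 1) : ℕ) : ℝ) / ((N s : ℕ) : ℝ)) atTop (𝓝 0))
    (hκ : Tendsto κ atTop (𝓝 0)) (hHm : Hm.Prec N) :
    HasU2Seminorm N Hm (fun n => ((f n - gluedStr S n : ℝ) : ℂ)) 0 := by
  have hbd : ∀ n, ‖((f n - gluedStr S n : ℝ) : ℂ)‖ ≤ 1 := fun n =>
    norm_sub_le_one_of_mem (hf n) (gluedStr_mem n)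
  have hbd' : ∀ s n, ‖((f n - (S s).g n : ℝ) : ℂ)‖ ≤ 1 := fun s n =>
    norm_sub_le_one_of_mem (hf n) ((S s).g_mem n)
  refine tendsto_mean_congr (W := numWindows N Hm) (T := fun s => N (s - 1))
    (φ := fun s n => gowersU2Interval (fun n => ((f n - gluedStr S n : ℝ) : ℂ)) (n - 1) (Hm s))
    (ψ := fun s n => gowersU2Interval (fun n => ((f n - (S s).g n : ℝ) : ℂ)) (n - 1) (Hm s))
    (b := 2) (fun s n => ?_) (fun s n h1 h2 => ?_) (tendsto_div_numWindows hHm hgrow) ?_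
  · have h1 := gowersU2Interval_nonneg (fun n => ((f n - gluedStr S n : ℝ) : ℂ)) (n - 1) (Hm s)
    have h2 := gowersU2Interval_le_two hbd (n - 1) (Hm s)
    have h3 := gowersU2Interval_nonneg (fun n => ((f n - (S s).g n : ℝ) : ℂ)) (n - 1) (Hm s)
    have h4 := gowersU2Interval_le_two (hbd' s) (n - 1) (Hm s)
    exact abs_le.2 ⟨by linarith, by linarith⟩
  · refine gowersU2Interval_congr fun k hk1 hk2 => ?_
    unfold numWindows at h2
    rw [gluedStr_eq hN (s := s) (by omega) (by omega)]
  · rw [Metric.tendsto_nhds]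
    intro δ hδ
    -- The splitting parameter `δ / 8` and a small `κ` give a sum below `N δ / 2`; the remaining
    -- factor `2` pays for `N ≤ 2 * numWindows`.
    have hε : 0 < δ / 8 := by positivity
    have hlim := hκ.const_mul (8 / (δ / 8) ^ 3)
    rw [mul_zero] at hlim
    filter_upwards [hlim.eventually (gt_mem_nhds (half_pos hδ)), hHm.eventually_le_numWindows]
      with s hs hW
    have hsum := sum_gowersU2Interval_le (N := N s) (H := Hm s)
      (F := fun n => ((f n - (S s).g n : ℝ) : ℂ)) (κ := κ s) (hbd' s) hε (fun h hh => by
        simpa only [Complex.ofReal_sub] using (S s).uniform h hh)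
    have hreidx : ∑ n ∈ Finset.Icc 1 (numWindows N Hm s),
        gowersU2Interval (fun n => ((f n - (S s).g n : ℝ) : ℂ)) (n - 1) (Hm s) =
        ∑ x ∈ Finset.range ((N s : ℕ) + 1 - Hm s),
          gowersU2Interval (fun n => ((f n - (S s).g n : ℝ) : ℂ)) x (Hm s) := by
      rw [numWindows, Finset.range_eq_Ico,
        ← Finset.sum_Ico_add_right_sub_eq (c := 1)]
      rfl
    have hN0 : (0 : ℝ) < (N s : ℕ) := by exact_mod_cast (N s).pos
    have hW' : ((N s : ℕ) : ℝ) ≤ 2 * (numWindows N Hm s : ℝ) := by exact_mod_cast hW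
    have hW0 : (0 : ℝ) < numWindows N Hm s := by linarith
    have hpos : 0 ≤ (1 / (numWindows N Hm s : ℝ)) * ∑ n ∈ Finset.Icc 1 (numWindows N Hm s),
        gowersU2Interval (fun n => ((f n - (S s).g n : ℝ) : ℂ)) (n - 1) (Hm s) :=
      mul_nonneg (by positivity) (Finset.sum_nonneg fun n _ => gowersU2Interval_nonneg _ _ _)
    rw [Real.dist_eq, sub_zero, abs_of_nonneg hpos, hreidx, one_div, inv_mul_lt_iff₀ hW0]
    refine hsum.trans_lt ?_
    have e1 : ((N s : ℕ) : ℝ) * (δ / 8) + 4 * (N s : ℕ) * κ s / (δ / 8) ^ 3 =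
        ((N s : ℕ) : ℝ) * (δ / 8 + 8 / (δ / 8) ^ 3 * κ s / 2) := by ring
    rw [e1]
    have h3 : δ / 8 + 8 / (δ / 8) ^ 3 * κ s / 2 < δ / 2 := by linarith
    calc _ < ((N s : ℕ) : ℝ) * (δ / 2) := by gcongr
      _ ≤ (2 * (numWindows N Hm s : ℝ)) * (δ / 2) := by gcongr
      _ = _ := by ring

theorem hasNormTwoAlong_gluedData (hN : Monotone fun s => (N s : ℕ))
    (hgrow : Tendsto (fun s => ((N (s - 1) : ℕ) : ℝ) / ((N s : ℕ) : ℝ)) atTop (𝓝 0)) {d : ℕ} {L : ℝ}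
    (hq : Tendsto (fun s => (S s).dist d) atTop (𝓝 L)) :
    HasNormTwoAlong N (fun n => (∑ i, (gluedData S d n i).1 *
      expTwoPiI ((n : ℝ) * (gluedData S d n i).2)) - (gluedStr S n : ℂ)) √L := by
  have hL : 0 ≤ L := ge_of_tendsto' hq fun s => ((S s).dist_mem_Icc d).1
  refine ⟨Real.sqrt_nonneg _, ?_⟩
  rw [Real.sq_sqrt hL]
  have hb : ∀ s n, ‖phaseSum ((S s).u d) n - ((S s).g n : ℂ)‖ ^ 2 ∈
      Set.Icc (0 : ℝ) (((d : ℝ) + 1) ^ 2) := fun s n => by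
    have h1 : ‖phaseSum ((S s).u d) n‖ ≤ d :=
      IsPhase.norm_le (N := N s) ⟨(S s).u d, (S s).norm_le d, fun _ => rfl, le_rfl⟩ n
    have h2 : ‖((S s).g n : ℂ)‖ ≤ 1 := by
      rw [Complex.norm_real, Real.norm_eq_abs, abs_of_nonneg ((S s).g_mem n).1]
      exact ((S s).g_mem n).2
    exact ⟨by positivity, by gcongr; exact (norm_sub_le _ _).trans (add_le_add h1 h2)⟩
  refine tendsto_mean_congr (W := fun s => N s) (T := fun s => N (s - 1))
    (φ := fun _ n => ‖(∑ i, (gluedData S d n i).1 *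
      expTwoPiI ((n : ℝ) * (gluedData S d n i).2)) - (gluedStr S n : ℂ)‖ ^ 2)
    (ψ := fun s n => ‖phaseSum ((S s).u d) n - ((S s).g n : ℂ)‖ ^ 2) (b := ((d : ℝ) + 1) ^ 2)
    (fun s n => ?_) (fun s n h1 h2 => ?_) hgrow hq
  · have h1 := hb (stageOf (fun s => N s) n) n
    have h2 := hb s n
    exact abs_sub_le_of_nonneg_of_le h1.1 h1.2 h2.1 h2.2
  · simp only [gluedStr_eq hN h1 h2, gluedData_eq hN h1 h2]
    rfl

/-- Each break spoils at most `H` windows and there are at most `N / Hp` breaks, so the spoiled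
share is at most about `H / Hp`. The map `π` covers amplitudes and frequencies at once. -/
theorem asymptoticallyFull_const {H : Scale} (hN : Monotone fun s => (N s : ℕ))
    (hgrow : Tendsto (fun s => ((N (s - 1) : ℕ) : ℝ) / ((N s : ℕ) : ℝ)) atTop (𝓝 0))
    (hNtop : N.OnePrec) (hHp : H.Prec Hp) (hHN : H.Prec N) (d : ℕ) {E : Type*}
    (π : ℂ × ℝ → E) :
    AsymptoticallyFull N H
      (fun s => LocallyConstantSet (fun i n => π (gluedData S d n i)) (H s)) := by
  classical
  refine asymptoticallyFull_of_forall_not_mem hHN (T := fun s => N (s - 1))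
    -- The last index is excluded because its window `{n + 1, …, n + H}` reaches `N + 1`.
    (E := fun s => insert (numWindows N H s) ((breakSet ((S s).u d) (N s)).biUnion
      fun k => Finset.Ico (k + 1 - H s) k)) (Eventually.of_forall fun s n hn1 hn2 hT hE => ?_)
    hgrow ?_
  · simp only [Finset.mem_insert, Finset.mem_biUnion, Finset.mem_Ico, not_or, not_exists,
      not_and] at hE
    have hnN : n + H s ≤ N s := by
      have := hE.1
      unfold numWindows at hn2 this
      omega
    have hnb : ∀ k ∈ breakSet ((S s).u d) (N s), ¬ (n < k ∧ k < n + H s) := fun k hk h =>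
      hE.2 k hk (by omega) h.1
    have key : ∀ m ∈ Finset.Icc 1 (H s : ℕ), gluedData S d (n + m) = (S s).u d (n + 1) :=
      fun m hm => by
        have hm' := Finset.mem_Icc.1 hm
        rw [gluedData_eq hN (s := s) (by omega) (by omega)]
        exact eq_of_no_break hnN hnb hm'.1 hm'.2
    intro i m₁ h₁ m₂ h₂
    simp only [key m₁ h₁, key m₂ h₂]
  · have hlim := hNtop.add hHp
    rw [add_zero] at hlim
    refine squeeze_zero (fun s => by positivity) (fun s => ?_) hlim
    have hN0 : (0 : ℝ) < (N s : ℕ) := by exact_mod_cast (N s).pos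
    have hHp0 : (0 : ℝ) < (Hp s : ℕ) := by exact_mod_cast (Hp s).pos
    have hcard : (insert (numWindows N H s) ((breakSet ((S s).u d) (N s)).biUnion
        fun k => Finset.Ico (k + 1 - H s) k)).card ≤ 1 + (breakSet ((S s).u d) (N s)).card * H s := by
      refine (Finset.card_insert_le _ _).trans ?_
      rw [add_comm]
      gcongr
      refine Finset.card_biUnion_le_card_mul _ _ _ fun k _ => ?_
      rw [Nat.card_Ico]
      omega
    have hbr : ((breakSet ((S s).u d) (N s)).card : ℝ) * (Hp s : ℕ) ≤ (N s : ℕ) := by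
      exact_mod_cast (S s).breaks d
    have hcard' : ((insert (numWindows N H s) ((breakSet ((S s).u d) (N s)).biUnion
        fun k => Finset.Ico (k + 1 - H s) k)).card : ℝ) ≤
        1 + (breakSet ((S s).u d) (N s)).card * (H s : ℕ) := by exact_mod_cast hcard
    calc _ ≤ (1 + ((breakSet ((S s).u d) (N s)).card : ℝ) * (H s : ℕ)) / (N s : ℕ) := by gcongr
      _ = 1 / (N s : ℕ) +
          ((breakSet ((S s).u d) (N s)).card : ℝ) * (H s : ℕ) / (N s : ℕ) := add_div _ _ _
      _ ≤ _ := by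
        refine add_le_add le_rfl ?_
        rw [div_le_div_iff₀ hN0 hHp0]
        nlinarith [(Nat.cast_nonneg (H s : ℕ) : (0 : ℝ) ≤ (H s : ℕ))]

theorem asymptoticallyFull_frequencyDichotomySet {H : Scale} (hN : Monotone fun s => (N s : ℕ))
    (hgrow : Tendsto (fun s => ((N (s - 1) : ℕ) : ℝ) / ((N s : ℕ) : ℝ)) atTop (𝓝 0))
    (hHm : Hm.Prec H) (hHp : H.Prec Hp) (hHN : H.Prec N) (d : ℕ) {C : ℝ} (hC : 1 ≤ C) :
    AsymptoticallyFull N H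
      (fun s => FrequencyDichotomySet (fun i n => (gluedData S d n i).2) C (H s)) := by
  refine asymptoticallyFull_of_forall_not_mem hHN (T := fun s => N (s - 1))
    (E := fun s => badFreqSet s (N s) (Hm s) (Hp s) (S s).u) ?_ hgrow ?_
  · have hC0 : 0 < C := by linarith
    -- Once `C * Hm ≤ H` and `C * H ≤ Hp`, any value strictly between `1 / (C H)` and `C / H` lies
    -- in `[1 / Hp, 1 / Hm)`; `s ≥ d` and `s ≥ C` put the combination among those counted in
    -- `badFreqSet`.
    filter_upwards [hHm.eventually_mul_le hC0, hHp.eventually_mul_le hC0, eventually_ge_atTop d,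
      eventually_ge_atTop ⌈C⌉₊] with s h1 h2 h3 h4 n hn1 hn2 hT hE w hw
    by_contra! hcon
    have hnN : n ≤ N s := by
      have := (H s).pos
      unfold numWindows at hn2
      omega
    have hH0 : (0 : ℝ) < (H s : ℕ) := by exact_mod_cast (H s).pos
    have hHm0 : (0 : ℝ) < (Hm s : ℕ) := by exact_mod_cast (Hm s).pos
    simp only [gluedData_eq hN hT hnN] at hcon
    simp only [badFreqSet, Finset.mem_filter] at hE
    refine hE ⟨Finset.mem_Icc.2 ⟨hn1, hnN⟩, d, h3, w, fun i => ?_, ?_, ?_⟩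
    · have h5 : C ≤ s := (Nat.le_ceil C).trans (by exact_mod_cast h4)
      have h6 := (hw i).trans h5
      exact_mod_cast h6
    · exact (one_div_le_one_div_of_le (by positivity) h2).trans hcon.1.le
    · refine hcon.2.trans_le ?_
      rw [div_le_div_iff₀ hH0 hHm0]
      linarith
  · refine squeeze_zero (fun s => by positivity) (fun s => ?_) tendsto_one_div_succ
    have hN0 : (0 : ℝ) < (N s : ℕ) := by exact_mod_cast (N s).pos
    rw [div_le_div_iff₀ hN0 (by positivity), one_mul]
    exact_mod_cast (S s).freq

theorem isU2GoodScale_of_strUnf (S : ∀ s, StrUnf f (κ s) s (N s) (Hm s) (Hp s))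
    (hf : ∀ n, 0 ≤ f n ∧ f n ≤ 1) (hN : Monotone fun s => (N s : ℕ))
    (hgrow : Tendsto (fun s => ((N (s - 1) : ℕ) : ℝ) / ((N s : ℕ) : ℝ)) atTop (𝓝 0))
    (hHm : Hm.OnePrec) (hHpN : ∀ s, Hp s ≤ N s) (hκ : Tendsto κ atTop (𝓝 0))
    (hq : ∀ d, Tendsto (fun s => (S s).dist d) atTop (𝓝 (q d)))
    (hq0 : ∀ ε > 0, ∀ᶠ d in atTop, q d ≤ ε) {H : Scale} (h1 : Hm.Prec H) (h2 : H.Prec Hp) :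
    IsU2GoodScale f N H := by
  have hHN : H.Prec N := h2.trans_le hHpN
  have hHmH : ∀ᶠ s in atTop, ((Hm s : ℕ) : ℝ) ≤ (H s : ℕ) := by
    simpa using h1.eventually_mul_le one_pos
  have hHleN : ∀ᶠ s in atTop, ((H s : ℕ) : ℝ) ≤ (N s : ℕ) := by
    simpa using hHN.eventually_mul_le one_pos
  have hNtop : N.OnePrec := by
    refine squeeze_zero' (Eventually.of_forall fun s => by positivity) ?_ hHm
    filter_upwards [hHmH, hHleN] with s hs hs'
    have : (0 : ℝ) < (Hm s : ℕ) := by exact_mod_cast (Hm s).pos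
    exact one_div_le_one_div_of_le this (hs.trans hs')
  have hHmN : Hm.Prec N := by
    refine squeeze_zero' (Eventually.of_forall fun s => by positivity) ?_ hHN
    filter_upwards [hHmH] with s hs
    gcongr
  refine ⟨?_, ?_, gluedStr S, fun n => f n - gluedStr S n, fun n => by ring, gluedStr_mem,
    hasMeanAlong_sub_gluedStr hf hN hgrow hκ, fun ε hε => ?_, Hm, hHm, h1,
    hasU2Seminorm_sub_gluedStr hf hN hgrow hκ hHmN⟩
  · refine squeeze_zero' (Eventually.of_forall fun s => by positivity) ?_ hHm
    filter_upwards [hHmH] with s hs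
    have : (0 : ℝ) < (Hm s : ℕ) := by exact_mod_cast (Hm s).pos
    exact one_div_le_one_div_of_le this hs
  · filter_upwards [hHleN] with s hs
    exact_mod_cast hs
  -- The threshold is `ε ^ 2` because `q d` is a limit of squared distances.
  · obtain ⟨d, hd, hd0⟩ := ((hq0 (ε ^ 2) (by positivity)).and (eventually_gt_atTop 0)).exists
    exact ⟨d, fun i n => (gluedData S d n i).1, fun i n => (gluedData S d n i).2, hd0,
      fun i n => (S _).norm_le d n i,
      ⟨√(q d), (Real.sqrt_le_left hε.le).2 hd, hasNormTwoAlong_gluedData hN hgrow (hq d)⟩,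
      asymptoticallyFull_const hN hgrow hNtop h2 hHN d Prod.snd,
      asymptoticallyFull_const hN hgrow hNtop h2 hHN d Prod.fst,
      fun C hC => asymptoticallyFull_frequencyDichotomySet hN hgrow h1 h2 hHN d hC⟩

end Glue

end

theorem mainTheorem4 (f : ℕ → ℝ) (hf : ∀ n, 0 ≤ f n ∧ f n ≤ 1)
    (N Kplus Kminus : Scale)
    (hKminus : Scale.OnePrec Kminus)
    (hK : Scale.Prec Kminus Kplus)
    (hKN : Scale.PrecEq Kplus N) :
    ∃ t : ℕ → ℕ, StrictMono t ∧
      ∃ Hplus Hminus : Scale,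
        Scale.PrecEq (fun s => Kminus (t s)) Hminus ∧
        Scale.Prec Hminus Hplus ∧
        Scale.PrecEq Hplus (fun s => Kplus (t s)) ∧
        ∀ H : Scale, Scale.Prec Hminus H → Scale.Prec H Hplus →
          IsU2GoodScale f (fun s => N (t s)) H := by
  obtain ⟨t, ht, Hm, Hp, κ, q, S, hsc, hgrow, hκ, hq, hq0⟩ :=
    exists_strUnf_growing hf (N := fun s => N s) (Kp := fun s => Kplus s)
      (Km := fun s => Kminus s) (fun s => (Kminus s).pos)
      (fun R => by
        filter_upwards [hK.eventually_mul_le (show (0 : ℝ) < R + 1 by positivity)] with s hs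
        have hs' : (R + 1) * (Kminus s : ℕ) ≤ Kplus s := by exact_mod_cast hs
        nlinarith)
      (by filter_upwards [hKN] with s hs; exact_mod_cast hs)
  have hHm0 : ∀ s, 0 < Hm s := fun s => (Kminus (t s)).pos.trans_le (hsc s).1
  have hHp0 : ∀ s, 0 < Hp s := fun s =>
    (Nat.mul_pos (Nat.succ_pos s) (hHm0 s)).trans_le (hsc s).2.1
  have hNmono : Monotone fun s => (N (t s) : ℕ) := monotone_nat_of_le_succ fun s =>
    (Nat.le_mul_of_pos_left _ (Nat.succ_pos s)).trans (hgrow s)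
  have hNlim : Tendsto (fun s => ((N (t (s - 1)) : ℕ) : ℝ) / ((N (t s) : ℕ) : ℝ))
      atTop (𝓝 0) := by
    rw [← tendsto_add_atTop_iff_nat 1]
    refine squeeze_zero (fun s => by positivity) (fun s => ?_) tendsto_one_div_succ
    have h0 : (0 : ℝ) < (N (t (s + 1)) : ℕ) := by exact_mod_cast (N (t (s + 1))).pos
    rw [div_le_div_iff₀ h0 (by positivity), Nat.add_sub_cancel, one_mul, mul_comm]
    exact_mod_cast hgrow s
  refine ⟨t, ht, fun s => ⟨Hp s, hHp0 s⟩, fun s => ⟨Hm s, hHm0 s⟩,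
    Eventually.of_forall fun s => (hsc s).1, ?_, Eventually.of_forall fun s => (hsc s).2.2.1,
    fun H h1 h2 => ?_⟩
  · refine squeeze_zero (fun s => by positivity) (fun s => ?_) tendsto_one_div_succ
    have h0 : (0 : ℝ) < Hp s := by exact_mod_cast hHp0 s
    show (Hm s : ℝ) / (Hp s : ℝ) ≤ _
    rw [div_le_div_iff₀ h0 (by positivity), one_mul, mul_comm]
    exact_mod_cast (hsc s).2.1
  · refine isU2GoodScale_of_strUnf (N := fun s => N (t s)) (Hm := fun s => ⟨Hm s, hHm0 s⟩)
      (Hp := fun s => ⟨Hp s, hHp0 s⟩) S hf hNmono hNlim ?_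
      (fun s => (hsc s).2.2.1.trans (hsc s).2.2.2) hκ hq hq0 h1 h2
    refine squeeze_zero (fun s => by positivity) (fun s => ?_)
      (hKminus.comp ht.tendsto_atTop)
    have h0 : (0 : ℝ) < (Kminus (t s) : ℕ) := by exact_mod_cast (Kminus (t s)).pos
    exact one_div_le_one_div_of_le h0 (by exact_mod_cast (hsc s).1)
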